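/- For $A\in\mathbb C^{n\times n}$ define the following sets, where $\langle x,y\rangle=x^*y$ and $\|\cdot\|$ is the Euclidean norm on $\mathbb C^n$. - The Davis–Wielandt shell $\mathrm{DW}(A)=\left\{\left(\frac{\langle x,Ax\rangle}{\|x\|^2},\frac{\|Ax\|^2}{\|x\|^2}\right): x\in\mathbb C^n,\ x\neq 0\right\}\subset\mathbb C\times\mathbb R$ and the inverse shell $\mathrm{DW}^{-1}(A)=f_{\mathrm{inv}}\big(\mathrm{DW}(A)\setminus\{(0,0)\}\big)$, where $f_{\mathrm{inv}}(z,\nu)=(\bar z/\nu,\,1/\nu)$ for $\nu>0$. - The scaled relative graph $\mathrm{SRG}(A)=\left\{\frac{\|y\|}{\|x\|}\exp\left(\pm i\arccos\frac{\mathrm{Re}\langle x,y\rangle}{\|x\|\|y\|}\right): y=Ax,\ y\neq0\right\}\subset\mathbb C$ and, for $\theta\in\mathbb R$, the $\theta$-SRG $\mathrm{SRG}_\theta(A)=e^{i\theta}\,\mathrm{SRG}(e^{-i\theta}A)$. - The inverse $\theta$-SRG $\mathrm{SRG}^{-1}_\theta(A)=g_\theta\big(\mathrm{DW}^{-1}(A)\big)\cup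 g_{\theta+\pi}\big(\mathrm{DW}^{-1}(A)\big)$, where $g_\theta(z,r)=e^{i\theta}\left(t+i\sqrt{r-t^2}\right)$ with $t=\mathrm{Re}(e^{-i\theta}z)$, for $|z|^2\le r$. (The same two maps carry $\mathrm{DW}(A)\setminus\{(0,0)\}$ onto $\mathrm{SRG}_\theta(A)$.) **Theorem.** Let $A,B\in\mathbb C^{n\times n}$. The following three conditions are equivalent: 1. $I+AU^*BU$ is nonsingular for every unitary $U\in\mathbb C^{n\times n}$; 2. there exists $\theta\in[-\pi/2,\pi/2)$ such that $\mathrm{SRG}^{-1}_\theta(A)\cap\mathrm{SRG}_\theta(-B)=\emptyset$; 3. $\mathrm{DW}^{-1}(A)\cap\mathrm{DW}(-B)=\emptyset$. -/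

import Mathlib

open scoped ComplexConjugate Matrix

noncomputable section

/-- The Davis-Wielandt shell of a square complex matrix `A`: the set of all points
`(⟪x, y⟫ / ‖x‖², ‖y‖² / ‖x‖²)` of `ℂ × ℝ` with `y = A x` and `x ≠ 0`. The inner product is
conjugate-linear in its first argument, and the norms are Euclidean. -/
def dwShell {n : ℕ} (A : Matrix (Fin n) (Fin n) ℂ) : Set (ℂ × ℝ) :=
  {p | ∃ x y : EuclideanSpace ℂ (Fin n), y = Matrix.toEuclideanLin A x ∧ x ≠ 0 ∧
    p = (inner ℂ x y / ((‖x‖ ^ 2 : ℝ) : ℂ), ‖y‖ ^ 2 / ‖x‖ ^ 2)}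

/-- The inversion map `(z, ν) ↦ (conj z / ν, 1 / ν)`; it is only applied to points with `ν > 0`. -/
def shellInv (p : ℂ × ℝ) : ℂ × ℝ := (conj p.1 / (p.2 : ℂ), 1 / p.2)

/-- The inverse Davis-Wielandt shell: the image of `dwShell A` without the point `(0, 0)` under
the inversion map. Since `A x = 0` forces `⟪x, A x⟫ = 0`, the removed point is the only point of
the shell whose last coordinate is not positive. -/
def invDwShell {n : ℕ} (A : Matrix (Fin n) (Fin n) ℂ) : Set (ℂ × ℝ) :=
  shellInv '' (dwShell A \ {(0, 0)})

/-- The scaled relative graph of `A`: all numbers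
`(‖y‖ / ‖x‖) exp (± i arccos (Re ⟪x, y⟫ / (‖x‖ ‖y‖)))` with `y = A x` and `y ≠ 0`
(so that `x ≠ 0` as well). -/
def srg {n : ℕ} (A : Matrix (Fin n) (Fin n) ℂ) : Set ℂ :=
  {w | ∃ x y : EuclideanSpace ℂ (Fin n), y = Matrix.toEuclideanLin A x ∧ y ≠ 0 ∧
    ∃ s : ℝ, (s = 1 ∨ s = -1) ∧
      w = ((‖y‖ / ‖x‖ : ℝ) : ℂ) *
        Complex.exp (((s * Real.arccos ((inner ℂ x y).re / (‖x‖ * ‖y‖)) : ℝ) : ℂ) * Complex.I)}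

/-- The `θ`-SRG (rotated scaled relative graph) `e^{iθ} SRG(e^{-iθ} A)`. -/
def thetaSrg {n : ℕ} (θ : ℝ) (A : Matrix (Fin n) (Fin n) ℂ) : Set ℂ :=
  (fun w : ℂ => Complex.exp (θ * Complex.I) * w) '' srg (Complex.exp (-(θ * Complex.I)) • A)

/-- The projection `(z, r) ↦ (Re z + i √(r - (Re z)²), r)` onto the upper half of the paraboloid
`|z|² = r`. It is only applied to points with `|z|² ≤ r`. -/
def parabProj (p : ℂ × ℝ) : ℂ × ℝ := (⟨p.1.re, √(p.2 - p.1.re ^ 2)⟩, p.2)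

/-- The rotated projection: rotate the first coordinate by `-θ`, apply `parabProj`, and rotate
back by `θ`. -/
def thetaProj (θ : ℝ) (p : ℂ × ℝ) : ℂ × ℝ :=
  let q := parabProj (Complex.exp (-(θ * Complex.I)) * p.1, p.2)
  (Complex.exp (θ * Complex.I) * q.1, q.2)

/-- The inverse `θ`-SRG of `A`: the set obtained from the inverse Davis-Wielandt shell in the same
way as the `θ`-SRG is obtained from the Davis-Wielandt shell. The two parts are those in the two
half planes bounded by the line `e^{iθ} ℝ`. -/
def invThetaSrg {n : ℕ} (θ : ℝ) (A : Matrix (Fin n) (Fin n) ℂ) : Set ℂ :=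
  (fun p => (thetaProj θ p).1) '' invDwShell A ∪
    (fun p => (thetaProj (θ + Real.pi) p).1) '' invDwShell A

end

/-! ### Hermitian and positive semidefinite matrices -/

section
open scoped ComplexOrder MatrixOrder

/-! All three conditions are governed by one system: vectors `w`, `u`, not both zero, such that the
pairs `(w, A w)` and `(-B u, u)` have the same Gram matrix, that is, `gramDefect` vanishes. Equal
Gram matrices mean that a unitary carries one pair to the other, which is singularity for some `U`
(`exists_unitary_not_isUnit_iff`). Dividing by `‖u‖² = ‖A w‖²` turns the same equations into a
common point of the two shells. A common point of the θ-SRGs keeps both norm equations, but only the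
real part, after rotation by `-θ`, of the inner product equation.

The hard step is thus to get a full zero from weakened zeros for every `θ`. These rule out a
hyperplane strictly separating 0 from the defects of unit vectors, so 0 lies in their convex hull
(`zero_mem_convexHull_gramDefect`). A convex combination yields factors `L₁`, `L₂` with `gram F (L₁
L₁ᴴ) = gram G (L₂ L₂ᴴ)`. Pairs of Hermitian matrices of sizes `m₁`, `m₂` have `m₁² + m₂²` real
parameters, against four Gram equations and one trace equation, so columns can be removed until `m₁²
+ m₂² ≤ 5` (`exists_gram_eq_le_five`). Either one column is left on each side, as wanted, or two on
one side and one on the other. The latter case is topological (`exists_gram_vecMulVec_eq`): the 2×2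
Hermitian matrix matching the Gram matrix of `y` has determinant 1 at one nonzero vector and at most
0 at an eigenvector, so it is singular at some `y ≠ 0`, hence of rank at most one. -/

theorem Matrix.IsHermitian.exists_unitary_diagonal {ι : Type*} [Fintype ι] [DecidableEq ι]
    {K : Matrix ι ι ℂ} (hK : K.IsHermitian) :
    ∃ (U : Matrix ι ι ℂ) (d : ι → ℝ), U * Uᴴ = 1 ∧ Uᴴ * U = 1 ∧
      K = U * Matrix.diagonal (fun i => (d i : ℂ)) * Uᴴ := by
  refine ⟨hK.eigenvectorUnitary, hK.eigenvalues, ?_, ?_, ?_⟩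
  · exact Matrix.mem_unitaryGroup_iff.1 hK.eigenvectorUnitary.2
  · exact Matrix.mem_unitaryGroup_iff'.1 hK.eigenvectorUnitary.2
  · have := hK.spectral_theorem
    rw [Unitary.conjStarAlgAut_apply] at this
    exact this

theorem posSemidef_unitary_diagonal {ι : Type*} [Fintype ι] [DecidableEq ι]
    (U : Matrix ι ι ℂ) {d : ι → ℝ} (hd : ∀ i, 0 ≤ d i) :
    (U * Matrix.diagonal (fun i => (d i : ℂ)) * Uᴴ).PosSemidef := by
  refine Matrix.PosSemidef.mul_mul_conjTranspose_same (Matrix.PosSemidef.diagonal ?_) U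
  intro i
  simpa using hd i

/-- Moving from the identity along a Hermitian direction one leaves the positive semidefinite cone
through a singular matrix. -/
theorem Matrix.IsHermitian.exists_posSemidef_singular {ι : Type*} [Fintype ι] [DecidableEq ι]
    {K : Matrix ι ι ℂ} (hK : K.IsHermitian) (hK0 : K ≠ 0) :
    ∃ t : ℝ, (1 + (t : ℂ) • K).PosSemidef ∧ ∃ v : ι → ℂ, v ≠ 0 ∧ (1 + (t : ℂ) • K) *ᵥ v = 0 := by
  obtain ⟨U, d, hU, hU', rfl⟩ := hK.exists_unitary_diagonal
  have hform : ∀ t : ℝ, 1 + (t : ℂ) • (U * Matrix.diagonal (fun i => (d i : ℂ)) * Uᴴ) =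
      U * Matrix.diagonal (fun i => ((1 + t * d i : ℝ) : ℂ)) * Uᴴ := by
    intro t
    have : Matrix.diagonal (fun i => ((1 + t * d i : ℝ) : ℂ)) =
        1 + (t : ℂ) • Matrix.diagonal (fun i => (d i : ℂ)) := by
      ext i j
      by_cases h : i = j
      · subst h; simp
      · simp [h]
    rw [this, mul_add, add_mul, mul_one, hU, Matrix.mul_smul, Matrix.smul_mul]
  obtain ⟨i₀, hi₀⟩ : ∃ i, d i ≠ 0 := by
    by_contra! h
    apply hK0
    simp [h]
  obtain ⟨m, -, hm⟩ := Finset.exists_max_image Finset.univ (fun i => |d i|) ⟨i₀, Finset.mem_univ _⟩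
  have hdm : d m ≠ 0 := by
    have := hm i₀ (Finset.mem_univ _)
    have h2 := abs_pos.2 hi₀
    exact abs_pos.1 (h2.trans_le this)
  -- As `|d m|` is maximal, all `1 - d i / d m` are nonnegative, and the one at `m` is zero.
  refine ⟨-(d m)⁻¹, ?_, U *ᵥ Pi.single m 1, ?_, ?_⟩
  · rw [hform]
    refine posSemidef_unitary_diagonal U fun i => ?_
    have h1 : |(d m)⁻¹ * d i| ≤ 1 := by
      rw [abs_mul, abs_inv]
      have := hm i (Finset.mem_univ _)
      rw [inv_mul_le_iff₀ (abs_pos.2 hdm)]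
      simpa using this
    have := (abs_le.1 h1).2
    linarith
  · intro h
    have h2 := congrArg (fun x => Uᴴ *ᵥ x) h
    simp only [Matrix.mulVec_mulVec, hU', Matrix.one_mulVec, Matrix.mulVec_zero] at h2
    have := congrFun h2 m
    simp at this
  · rw [hform, Matrix.mulVec_mulVec, mul_assoc, hU', mul_one, ← Matrix.mulVec_mulVec,
      Matrix.diagonal_mulVec_single]
    simp [hdm]

theorem Matrix.PosSemidef.exists_eq_mul_conjTranspose {ι : Type*} [Fintype ι] [DecidableEq ι]
    {P : Matrix ι ι ℂ} (hP : P.PosSemidef) : ∃ M : Matrix ι ι ℂ, P = M * Mᴴ := by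
  obtain ⟨M, hM⟩ := CStarAlgebra.nonneg_iff_eq_star_mul_self.1 hP.nonneg
  exact ⟨Mᴴ, by rw [Matrix.conjTranspose_conjTranspose]; exact hM⟩

/-- A zero eigenvalue contributes nothing to the spectral decomposition, so its column can be
dropped. -/
theorem Matrix.PosSemidef.exists_eq_mul_conjTranspose_of_singular {m : ℕ}
    {P : Matrix (Fin (m + 1)) (Fin (m + 1)) ℂ} (hP : P.PosSemidef) {v : Fin (m + 1) → ℂ}
    (hv : v ≠ 0) (hPv : P *ᵥ v = 0) :
    ∃ M : Matrix (Fin (m + 1)) (Fin m) ℂ, P = M * Mᴴ := by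
  obtain ⟨U, d, hU, hU', hPd⟩ := hP.isHermitian.exists_unitary_diagonal
  have hdiag : Matrix.diagonal (fun i => (d i : ℂ)) = Uᴴ * P * U := by
    rw [hPd]
    simp only [mul_assoc, hU', mul_one]
    rw [← mul_assoc, hU', one_mul]
  have hd : ∀ i, 0 ≤ d i := by
    intro i
    have h := (hP.conjTranspose_mul_mul_same U).diag_nonneg (i := i)
    rw [← hdiag] at h
    simpa using h
  obtain ⟨i₀, hi₀⟩ : ∃ i, d i = 0 := by
    by_contra! h
    apply hv
    have h1 : Matrix.diagonal (fun i => (d i : ℂ)) *ᵥ (Uᴴ *ᵥ v) = 0 := by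
      rw [hdiag, Matrix.mulVec_mulVec, mul_assoc, hU, mul_one, ← Matrix.mulVec_mulVec, hPv,
        Matrix.mulVec_zero]
    have h2 : Uᴴ *ᵥ v = 0 := by
      ext i
      have := congrFun h1 i
      rw [Matrix.mulVec_diagonal] at this
      simpa [h i] using this
    calc v = U *ᵥ (Uᴴ *ᵥ v) := by rw [Matrix.mulVec_mulVec, hU, Matrix.one_mulVec]
      _ = 0 := by rw [h2, Matrix.mulVec_zero]
  refine ⟨Matrix.of fun a k => U a (i₀.succAbove k) * (√(d (i₀.succAbove k)) : ℝ), ?_⟩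
  rw [hPd]
  ext a b
  rw [Matrix.mul_apply, Matrix.mul_apply, Fin.sum_univ_succAbove _ i₀]
  simp only [Matrix.mul_diagonal, hi₀, Matrix.conjTranspose_apply, Matrix.of_apply]
  simp only [Complex.ofReal_zero, mul_zero, zero_mul, zero_add]
  refine Finset.sum_congr rfl fun k _ => ?_
  have : ((√(d (i₀.succAbove k)) : ℝ) : ℂ) * (√(d (i₀.succAbove k)) : ℝ) = d (i₀.succAbove k) := by
    rw [← Complex.ofReal_mul, Real.mul_self_sqrt (hd _)]
  rw [← this]
  simp
  ring

/-- The determinant is the product of just two eigenvalues, which therefore cannot have opposite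
signs. -/
theorem Matrix.IsHermitian.posSemidef_or_posSemidef_neg {X : Matrix (Fin 2) (Fin 2) ℂ}
    (hX : X.IsHermitian) (hdet : 0 ≤ X.det.re) : X.PosSemidef ∨ (-X).PosSemidef := by
  obtain ⟨U, d, hU, hU', hXd⟩ := hX.exists_unitary_diagonal
  have h1 : X.det = ((d 0 * d 1 : ℝ) : ℂ) := by
    have h2 : U.det * Uᴴ.det = 1 := by rw [← Matrix.det_mul, hU, Matrix.det_one]
    rw [hXd, Matrix.det_mul, Matrix.det_mul, mul_right_comm, h2, one_mul, Matrix.det_diagonal,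
      Fin.prod_univ_two, Complex.ofReal_mul]
  rw [h1, Complex.ofReal_re] at hdet
  rcases mul_nonneg_iff.1 hdet with h | h
  · left
    rw [hXd]
    exact posSemidef_unitary_diagonal U (Fin.forall_fin_two.2 h)
  · right
    have h3 : -X = U * Matrix.diagonal (fun i => ((-d i : ℝ) : ℂ)) * Uᴴ := by
      have : Matrix.diagonal (fun i => ((-d i : ℝ) : ℂ)) =
          -Matrix.diagonal (fun i => (d i : ℂ)) := by
        rw [Matrix.diagonal_neg]
        simp
      rw [hXd, this, Matrix.mul_neg, Matrix.neg_mul]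
    rw [h3]
    exact posSemidef_unitary_diagonal U (Fin.forall_fin_two.2 (by simpa using h))

theorem Matrix.IsHermitian.det_im {ι : Type*} [Fintype ι] [DecidableEq ι] {X : Matrix ι ι ℂ}
    (hX : X.IsHermitian) : X.det.im = 0 := by
  have := Matrix.det_conjTranspose X
  rw [hX.eq] at this
  exact Complex.conj_eq_iff_im.1 this.symm

/-! ### Gram matrices of pairs of matrices -/

noncomputable section

/-- The Gram matrix of a pair of matrices with respect to the sesquilinear form given by `X`. -/
def gram {κ ι : Type*} [Fintype κ] [Fintype ι] (F : Fin 2 → Matrix κ ι ℂ) :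
    Matrix ι ι ℂ →ₗ[ℂ] Matrix (Fin 2) (Fin 2) ℂ where
  toFun X := Matrix.of fun i j => (F i * X * (F j)ᴴ).trace
  map_add' X Y := by ext; simp [Matrix.mul_add, Matrix.add_mul]
  map_smul' c X := by ext; simp

section
variable {κ ι ι' : Type*} [Fintype κ] [Fintype ι] [Fintype ι']

theorem gram_apply (F : Fin 2 → Matrix κ ι ℂ) (X : Matrix ι ι ℂ) (i j : Fin 2) :
    gram F X i j = (F i * X * (F j)ᴴ).trace := rfl

theorem gram_conjTranspose (F : Fin 2 → Matrix κ ι ℂ) (X : Matrix ι ι ℂ) :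
    gram F Xᴴ = (gram F X)ᴴ := by
  ext i j
  rw [Matrix.conjTranspose_apply, gram_apply, gram_apply, ← Matrix.trace_conjTranspose]
  simp [Matrix.mul_assoc]

theorem gram_mul (F : Fin 2 → Matrix κ ι ℂ) (L : Matrix ι ι' ℂ) (X : Matrix ι' ι' ℂ) :
    gram (fun i => F i * L) X = gram F (L * X * Lᴴ) := by
  ext i j
  simp [gram_apply, Matrix.mul_assoc]

/-- This is how a Gram matrix detects singularity of the pencil `∑ i, c i • F i`. -/
theorem gram_contract (F : Fin 2 → Matrix κ ι ℂ) (c : Fin 2 → ℂ) (X : Matrix ι ι ℂ) :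
    ∑ i, ∑ j, c i * star (c j) * gram F X i j =
      ((∑ i, c i • F i) * X * (∑ i, c i • F i)ᴴ).trace := by
  simp only [gram_apply, Fin.sum_univ_two, Matrix.conjTranspose_add, Matrix.conjTranspose_smul,
    Matrix.add_mul, Matrix.mul_add, Matrix.trace_add, Matrix.smul_mul, Matrix.mul_smul,
    Matrix.trace_smul, smul_eq_mul]
  ring

theorem gram_self_nonneg (F : Fin 2 → Matrix κ ι ℂ) {X : Matrix ι ι ℂ} (hX : X.PosSemidef)
    (i : Fin 2) : 0 ≤ gram F X i i :=
  (hX.mul_mul_conjTranspose_same (F i)).trace_nonneg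

/-- The diagonal entries are squared Frobenius norms of `F i * L`, so the columns of `L` lie in the
common kernel of the `F i`. -/
theorem eq_zero_of_gram_eq_zero {F : Fin 2 → Matrix κ ι ℂ}
    (hF : ∀ v, (∀ i, F i *ᵥ v = 0) → v = 0) {L : Matrix ι ι' ℂ} (h : ∀ i, gram F (L * Lᴴ) i i = 0) :
    L = 0 := by
  have h1 : ∀ i, F i * L = 0 := by
    intro i
    have := h i
    rw [gram_apply] at this
    rw [← Matrix.trace_mul_conjTranspose_self_eq_zero_iff]
    simpa [Matrix.mul_assoc] using this
  ext a b
  have h2 : (fun a => L a b) = 0 := by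
    refine hF _ fun i => ?_
    ext k
    exact congrFun (congrFun (h1 i) k) b
  exact congrFun h2 a

end
end
end

/-! ### Rank reduction down to single vectors -/

section
open scoped ComplexOrder MatrixOrder

/-- If `x + star x` vanishes, then `x` is skew and `I • x` is self-adjoint. -/
theorem Submodule.exists_isSelfAdjoint_ne_zero {V : Type*} [AddCommGroup V] [StarAddMonoid V]
    [Module ℂ V] [StarModule ℂ V] {p : Submodule ℂ V} (hp : p ≠ ⊥) (hstar : ∀ x ∈ p, star x ∈ p) :
    ∃ x ∈ p, IsSelfAdjoint x ∧ x ≠ 0 := by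
  obtain ⟨x, hx, hx0⟩ := p.exists_mem_ne_zero_of_ne_bot hp
  by_cases h : x + star x = 0
  · refine ⟨Complex.I • x, p.smul_mem _ hx, ?_, by simpa using hx0⟩
    have : star x = -x := (neg_eq_of_add_eq_zero_right h).symm
    rw [IsSelfAdjoint, star_smul, this]
    simp
  · exact ⟨x + star x, p.add_mem hx (hstar x hx), IsSelfAdjoint.add_star_self x, h⟩

theorem trace_mul_conjTranspose_add_ne_zero {κ ι₁ ι₂ : Type*} [Fintype κ] [Fintype ι₁] [Fintype ι₂]
    {L₁ : Matrix κ ι₁ ℂ} {L₂ : Matrix κ ι₂ ℂ} (h : L₁ ≠ 0 ∨ L₂ ≠ 0) :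
    (L₁ * L₁ᴴ).trace + (L₂ * L₂ᴴ).trace ≠ 0 := by
  intro h0
  have h1 := (Matrix.posSemidef_self_mul_conjTranspose L₁).trace_nonneg
  have h2 := (Matrix.posSemidef_self_mul_conjTranspose L₂).trace_nonneg
  obtain ⟨e1, e2⟩ := (add_eq_zero_iff_of_nonneg h1 h2).1 h0
  rw [Matrix.trace_mul_conjTranspose_self_eq_zero_iff] at e1 e2
  exact h.elim (fun h => h e1) (fun h => h e2)

/-- Fewer columns suffice to realise a common Gram matrix as soon as the number of Hermitian
parameters exceeds the number of equations. -/
theorem exists_gram_eq_of_five_lt {κ : Type*} [Fintype κ] (F G : Fin 2 → Matrix κ κ ℂ) {m₁ m₂ : ℕ}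
    {L₁ : Matrix κ (Fin m₁) ℂ} {L₂ : Matrix κ (Fin m₂) ℂ}
    (h : gram F (L₁ * L₁ᴴ) = gram G (L₂ * L₂ᴴ)) (h0 : L₁ ≠ 0 ∨ L₂ ≠ 0)
    (hm : 5 < m₁ ^ 2 + m₂ ^ 2) :
    ∃ (k₁ k₂ : ℕ) (N₁ : Matrix κ (Fin k₁) ℂ) (N₂ : Matrix κ (Fin k₂) ℂ), k₁ + k₂ < m₁ + m₂ ∧
      gram F (N₁ * N₁ᴴ) = gram G (N₂ * N₂ᴴ) ∧ (N₁ ≠ 0 ∨ N₂ ≠ 0) := by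
  let V := Matrix (Fin m₁) (Fin m₁) ℂ × Matrix (Fin m₂) (Fin m₂) ℂ
  let T₁ : Matrix (Fin m₁) (Fin m₁) ℂ →ₗ[ℂ] ℂ :=
    { toFun := fun X => (L₁ * X * L₁ᴴ).trace
      map_add' := fun X Y => by simp [Matrix.mul_add, Matrix.add_mul]
      map_smul' := fun c X => by simp }
  let T₂ : Matrix (Fin m₂) (Fin m₂) ℂ →ₗ[ℂ] ℂ :=
    { toFun := fun X => (L₂ * X * L₂ᴴ).trace
      map_add' := fun X Y => by simp [Matrix.mul_add, Matrix.add_mul]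
      map_smul' := fun c X => by simp }
  -- Four coordinates preserve the equality of Gram matrices; the fifth fixes the total trace, which
  -- keeps the new factors from both vanishing.
  let Ψ : V →ₗ[ℂ] Matrix (Fin 2) (Fin 2) ℂ × ℂ :=
    LinearMap.prod
      ((gram fun i => F i * L₁) ∘ₗ LinearMap.fst ℂ _ _ -
        (gram fun i => G i * L₂) ∘ₗ LinearMap.snd ℂ _ _)
      (T₁ ∘ₗ LinearMap.fst ℂ _ _ + T₂ ∘ₗ LinearMap.snd ℂ _ _)
  have hker : ∀ K : V, K ∈ LinearMap.ker Ψ ↔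
      gram F (L₁ * K.1 * L₁ᴴ) = gram G (L₂ * K.2 * L₂ᴴ) ∧
        (L₁ * K.1 * L₁ᴴ).trace + (L₂ * K.2 * L₂ᴴ).trace = 0 := by
    intro K
    rw [LinearMap.mem_ker, ← gram_mul, ← gram_mul, ← sub_eq_zero (a := gram _ _)]
    exact Prod.ext_iff
  have hΨ : LinearMap.ker Ψ ≠ ⊥ := by
    apply LinearMap.ker_ne_bot_of_finrank_lt
    simp only [V, Module.finrank_prod, Module.finrank_matrix, Fintype.card_fin,
      Module.finrank_self]
    linarith
  obtain ⟨⟨K₁, K₂⟩, hK, hsa, hK0⟩ := Submodule.exists_isSelfAdjoint_ne_zero hΨ (by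
    rintro ⟨K₁, K₂⟩ hK
    rw [hker] at hK ⊢
    obtain ⟨e1, e2⟩ := hK
    have c : ∀ {m : ℕ} (L : Matrix κ (Fin m) ℂ) (X : Matrix (Fin m) (Fin m) ℂ),
        L * Xᴴ * Lᴴ = (L * X * Lᴴ)ᴴ := by
      intro m L X
      simp [Matrix.mul_assoc]
    refine ⟨?_, ?_⟩
    · have := congrArg Matrix.conjTranspose e1
      rw [← gram_conjTranspose, ← gram_conjTranspose, ← c, ← c] at this
      exact this
    · have := congrArg star e2
      rw [star_add, ← Matrix.trace_conjTranspose, ← Matrix.trace_conjTranspose, ← c, ← c,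
        star_zero] at this
      exact this)
  rw [hker] at hK
  obtain ⟨e1, e2⟩ := hK
  simp only at e1 e2
  have hsa1 : K₁.IsHermitian := congrArg Prod.fst hsa
  have hsa2 : K₂.IsHermitian := congrArg Prod.snd hsa
  -- Treating both blocks as one matrix gives the same `t` for both.
  have hB : (Matrix.fromBlocks K₁ 0 0 K₂).IsHermitian := by
    rw [Matrix.isHermitian_fromBlocks_iff]
    exact ⟨hsa1, by simp, by simp, hsa2⟩
  obtain ⟨t, hpsd, v, hv, hPv⟩ := hB.exists_posSemidef_singular (by
    intro h
    rw [← Matrix.fromBlocks_zero, Matrix.fromBlocks_inj] at h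
    exact hK0 (Prod.ext h.1 h.2.2.2))
  have hblock : 1 + (t : ℂ) • Matrix.fromBlocks K₁ 0 0 K₂ =
      Matrix.fromBlocks (1 + (t : ℂ) • K₁) 0 0 (1 + (t : ℂ) • K₂) := by
    rw [← Matrix.fromBlocks_one, Matrix.fromBlocks_smul, Matrix.fromBlocks_add]
    simp
  rw [hblock] at hpsd hPv
  have hp1 : (1 + (t : ℂ) • K₁).PosSemidef := hpsd.submatrix Sum.inl
  have hp2 : (1 + (t : ℂ) • K₂).PosSemidef := hpsd.submatrix Sum.inr
  have hfin : ∀ {k₁ k₂ : ℕ} (M₁ : Matrix (Fin m₁) (Fin k₁) ℂ) (M₂ : Matrix (Fin m₂) (Fin k₂) ℂ),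
      1 + (t : ℂ) • K₁ = M₁ * M₁ᴴ → 1 + (t : ℂ) • K₂ = M₂ * M₂ᴴ →
      gram F (L₁ * M₁ * (L₁ * M₁)ᴴ) = gram G (L₂ * M₂ * (L₂ * M₂)ᴴ) ∧
        (L₁ * M₁ ≠ 0 ∨ L₂ * M₂ ≠ 0) := by
    intro k₁ k₂ M₁ M₂ h1 h2
    have c : ∀ {m k : ℕ} (L : Matrix κ (Fin m) ℂ) (M : Matrix (Fin m) (Fin k) ℂ)
        (K : Matrix (Fin m) (Fin m) ℂ), 1 + (t : ℂ) • K = M * Mᴴ →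
        L * M * (L * M)ᴴ = L * Lᴴ + (t : ℂ) • (L * K * Lᴴ) := by
      intro m k L M K hM
      have : L * M * (L * M)ᴴ = L * (M * Mᴴ) * Lᴴ := by simp [Matrix.mul_assoc]
      rw [this, ← hM, Matrix.mul_add, Matrix.add_mul, Matrix.mul_one, Matrix.mul_smul,
        Matrix.smul_mul]
    refine ⟨?_, ?_⟩
    · rw [c L₁ M₁ K₁ h1, c L₂ M₂ K₂ h2, map_add, map_add, map_smul, map_smul, h, e1]
    · by_contra! hz
      have htr : (L₁ * M₁ * (L₁ * M₁)ᴴ).trace + (L₂ * M₂ * (L₂ * M₂)ᴴ).trace =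
          (L₁ * L₁ᴴ).trace + (L₂ * L₂ᴴ).trace := by
        rw [c L₁ M₁ K₁ h1, c L₂ M₂ K₂ h2, Matrix.trace_add, Matrix.trace_add, Matrix.trace_smul,
          Matrix.trace_smul, smul_eq_mul, smul_eq_mul]
        linear_combination (t : ℂ) * e2
      rw [hz.1, hz.2] at htr
      exact trace_mul_conjTranspose_add_ne_zero h0 (by rw [← htr]; simp)
  rw [Matrix.fromBlocks_mulVec] at hPv
  have hv1 : (1 + (t : ℂ) • K₁) *ᵥ (v ∘ Sum.inl) = 0 := by
    ext i
    simpa using congrFun hPv (Sum.inl i)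
  have hv2 : (1 + (t : ℂ) • K₂) *ᵥ (v ∘ Sum.inr) = 0 := by
    ext i
    simpa using congrFun hPv (Sum.inr i)
  -- The null vector is nonzero in some block; that block loses a column while the other keeps its
  -- size.
  by_cases hz : v ∘ Sum.inl = 0
  · have hz2 : v ∘ Sum.inr ≠ 0 := by
      intro hz2
      apply hv
      ext i
      rcases i with i | i
      · exact congrFun hz i
      · exact congrFun hz2 i
    obtain ⟨M₁, hM₁⟩ := hp1.exists_eq_mul_conjTranspose
    cases m₂ with
    | zero => exact absurd (Subsingleton.elim _ _) hz2
    | succ m =>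
      obtain ⟨M₂, hM₂⟩ := hp2.exists_eq_mul_conjTranspose_of_singular hz2 hv2
      exact ⟨m₁, m, L₁ * M₁, L₂ * M₂, by omega, hfin M₁ M₂ hM₁ hM₂⟩
  · obtain ⟨M₂, hM₂⟩ := hp2.exists_eq_mul_conjTranspose
    cases m₁ with
    | zero => exact absurd (Subsingleton.elim _ _) hz
    | succ m =>
      obtain ⟨M₁, hM₁⟩ := hp1.exists_eq_mul_conjTranspose_of_singular hz hv1
      exact ⟨m, m₂, L₁ * M₁, L₂ * M₂, by omega, hfin M₁ M₂ hM₁ hM₂⟩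

theorem exists_gram_eq_le_five {κ : Type*} [Fintype κ] (F G : Fin 2 → Matrix κ κ ℂ) {m₁ m₂ : ℕ}
    {L₁ : Matrix κ (Fin m₁) ℂ} {L₂ : Matrix κ (Fin m₂) ℂ}
    (h : gram F (L₁ * L₁ᴴ) = gram G (L₂ * L₂ᴴ)) (h0 : L₁ ≠ 0 ∨ L₂ ≠ 0) :
    ∃ (k₁ k₂ : ℕ) (N₁ : Matrix κ (Fin k₁) ℂ) (N₂ : Matrix κ (Fin k₂) ℂ), k₁ ^ 2 + k₂ ^ 2 ≤ 5 ∧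
      gram F (N₁ * N₁ᴴ) = gram G (N₂ * N₂ᴴ) ∧ (N₁ ≠ 0 ∨ N₂ ≠ 0) := by
  induction hn : m₁ + m₂ using Nat.strong_induction_on generalizing m₁ m₂ with
  | _ n ih =>
    subst hn
    by_cases hm : m₁ ^ 2 + m₂ ^ 2 ≤ 5
    · exact ⟨m₁, m₂, L₁, L₂, hm, h, h0⟩
    · obtain ⟨k₁, k₂, N₁, N₂, hlt, h', h0'⟩ := exists_gram_eq_of_five_lt F G h h0 (by omega)
      exact ih _ hlt h' h0' rfl

/-- A two-dimensional family of vectors whose summed Gram matrix is that of a single vector `y₀`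
contains a vector with the same Gram matrix as some nonzero `y`, provided the second pencil is
singular at some nonzero `y₁`. -/
theorem exists_gram_vecMulVec_eq {κ κ' ι : Type*} [Fintype κ] [Fintype κ'] [Fintype ι]
    (F : Fin 2 → Matrix κ (Fin 2) ℂ) (G : Fin 2 → Matrix κ' ι ℂ)
    (hG : ∀ v, (∀ i, G i *ᵥ v = 0) → v = 0) {y₀ y₁ : ι → ℂ} (hy₀ : y₀ ≠ 0) (hy₁ : y₁ ≠ 0)
    (h : gram F 1 = gram G (Matrix.vecMulVec y₀ (star y₀)))
    {c : Fin 2 → ℂ} (hc : c ≠ 0) (hcy : (∑ i, c i • G i) *ᵥ y₁ = 0) :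
    ∃ (v : Fin 2 → ℂ) (y : ι → ℂ), y ≠ 0 ∧
      gram F (Matrix.vecMulVec v (star v)) = gram G (Matrix.vecMulVec y (star y)) := by
  have hcol : ∀ M : Matrix (Fin 2) (Fin 1) ℂ,
      M * Mᴴ = Matrix.vecMulVec (fun i => M i 0) (star fun i => M i 0) := by
    intro M
    ext i j
    simp [Matrix.mul_apply, Matrix.vecMulVec_apply]
  by_cases hinj : LinearMap.ker (gram F) = ⊥
  swap
  -- Moving from the identity along the kernel to a singular matrix leaves one column and does not
  -- change the Gram matrix.
  · obtain ⟨K, hK, hsa, hK0⟩ := Submodule.exists_isSelfAdjoint_ne_zero hinj (by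
      intro K hK
      rw [LinearMap.mem_ker] at hK ⊢
      rw [Matrix.star_eq_conjTranspose, gram_conjTranspose, hK, Matrix.conjTranspose_zero])
    have hsa' : K.IsHermitian := hsa
    obtain ⟨t, hpsd, v, hv, hPv⟩ := hsa'.exists_posSemidef_singular hK0
    obtain ⟨M, hM⟩ := hpsd.exists_eq_mul_conjTranspose_of_singular hv hPv
    refine ⟨fun i => M i 0, y₀, hy₀, ?_⟩
    rw [← hcol, ← hM, map_add, map_smul, LinearMap.mem_ker.1 hK, smul_zero, add_zero, h]
  have hinj' := LinearMap.ker_eq_bot.1 hinj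
  have hsurj : Function.Surjective (gram F) := LinearMap.injective_iff_surjective.1 hinj'
  let e := LinearEquiv.ofBijective (gram F) ⟨hinj', hsurj⟩
  let X : (ι → ℂ) → Matrix (Fin 2) (Fin 2) ℂ := fun y => e.symm (gram G (Matrix.vecMulVec y (star y)))
  have hX : ∀ y, gram F (X y) = gram G (Matrix.vecMulVec y (star y)) := fun y =>
    e.apply_symm_apply _
  have hXcont : Continuous X := by
    have h1 : Continuous (e.symm.toLinearMap ∘ₗ gram G) :=
      LinearMap.continuous_of_finiteDimensional _
    have h2 : Continuous fun y : ι → ℂ => Matrix.vecMulVec y (star y) :=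
      continuous_id.matrix_vecMulVec continuous_star
    exact h1.comp h2
  have hXherm : ∀ y, (X y).IsHermitian := by
    intro y
    apply hinj'
    rw [gram_conjTranspose, hX, ← gram_conjTranspose, Matrix.conjTranspose_vecMulVec, star_star]
  have hX0 : X y₀ = 1 := hinj' (by rw [hX, h])
  have hvec : ∀ y : ι → ℂ, Matrix.vecMulVec y (star y) =
      Matrix.replicateCol Unit y * (Matrix.replicateCol Unit y)ᴴ := by
    intro y
    ext i j
    simp [Matrix.mul_apply, Matrix.vecMulVec_apply]
  -- A positive determinant would make `X y₁` definite. The pencil `∑ i, d i • G i` of the second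
  -- family, with coefficients `c`, kills `y₁`, so the first pencil `D` would satisfy `D * X y₁ =
  -- 0`, hence `D = 0`, against surjectivity of `gram F`.
  have hneg : (X y₁).det.re ≤ 0 := by
    by_contra! hpos
    have hunit : IsUnit (X y₁).det := by
      rw [isUnit_iff_ne_zero]
      intro h0
      simp [h0] at hpos
    set D := ∑ i, c i • F i with hD
    have htr : (D * X y₁ * Dᴴ).trace = 0 := by
      rw [hD, ← gram_contract, hX, gram_contract, hvec, ← Matrix.mul_assoc,
        ← Matrix.replicateCol_mulVec, hcy]
      simp
    have hDX : D * X y₁ = 0 := by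
      rcases (hXherm y₁).posSemidef_or_posSemidef_neg hpos.le with hp | hp
      · obtain ⟨M, hM⟩ := hp.exists_eq_mul_conjTranspose
        have h1 : (D * M * (D * M)ᴴ).trace = 0 := by
          rw [← htr, hM]
          simp [Matrix.mul_assoc]
        rw [Matrix.trace_mul_conjTranspose_self_eq_zero_iff] at h1
        rw [hM, ← Matrix.mul_assoc, h1, Matrix.zero_mul]
      · obtain ⟨M, hM⟩ := hp.exists_eq_mul_conjTranspose
        rw [neg_eq_iff_eq_neg] at hM
        have h1 : (D * M * (D * M)ᴴ).trace = 0 := by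
          rw [← neg_eq_zero, ← htr, hM]
          simp [Matrix.mul_assoc]
        rw [Matrix.trace_mul_conjTranspose_self_eq_zero_iff] at h1
        rw [hM, Matrix.mul_neg, ← Matrix.mul_assoc, h1, Matrix.zero_mul, neg_zero]
    have hD0 : D = 0 := by
      rw [← Matrix.mul_nonsing_inv_cancel_right _ D hunit, hDX, Matrix.zero_mul]
    -- Contracting this matrix with `c` gives the square of `∑ i, c i * star (c i)`, nonzero for `c
    -- ≠ 0`.
    obtain ⟨Z, hZ⟩ := hsurj (Matrix.vecMulVec (star c) c)
    have h2 := gram_contract F c Z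
    rw [hZ, ← hD, hD0] at h2
    have h3 : ∑ i, ∑ j, c i * star (c j) * Matrix.vecMulVec (star c) c i j =
        (∑ i, c i * star (c i)) ^ 2 := by
      simp only [Matrix.vecMulVec_apply, Fin.sum_univ_two, Pi.star_apply]
      ring
    rw [h3] at h2
    have h4 : c ⬝ᵥ star c = 0 := by
      simpa [dotProduct] using h2
    exact hc (dotProduct_self_star_eq_zero.1 h4)
  -- The punctured space is connected because its real dimension is at least two.
  obtain ⟨y, hy, hdet⟩ : ∃ y, y ≠ 0 ∧ (X y).det.re = 0 := by
    have hne : Nonempty ι := by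
      by_contra! hemp
      exact hy₀ (Subsingleton.elim _ _)
    have hrank : 1 < Module.rank ℝ (ι → ℂ) := by
      rw [← Module.finrank_eq_rank, Module.finrank_pi_fintype]
      simp only [Complex.finrank_real_complex, Finset.sum_const, Finset.card_univ, smul_eq_mul]
      have := Fintype.card_pos (α := ι)
      exact_mod_cast (by omega : 1 < Fintype.card ι * 2)
    have hcon := (isConnected_compl_singleton_of_one_lt_rank hrank 0).isPreconnected
    have hf : Continuous fun y => (X y).det.re := Complex.continuous_re.comp hXcont.matrix_det
    obtain ⟨y, hy, h0⟩ := hcon.intermediate_value (a := y₁) (b := y₀) hy₁ hy₀ hf.continuousOn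
      (show (0 : ℝ) ∈ Set.Icc _ _ from ⟨hneg, by simp [hX0]⟩)
    exact ⟨y, hy, h0⟩
  have hpsd : (X y).PosSemidef := by
    -- In the negative case the diagonal Gram entries of `y` are both nonpositive and nonnegative,
    -- so regularity of `G` forces `y = 0`.
    refine ((hXherm y).posSemidef_or_posSemidef_neg hdet.ge).resolve_right fun hn => hy ?_
    have h0 : Matrix.replicateCol Unit y = 0 := by
      refine eq_zero_of_gram_eq_zero hG fun i => ?_
      have h1 := gram_self_nonneg F hn i
      have h2 := gram_self_nonneg G
        (Matrix.posSemidef_self_mul_conjTranspose (Matrix.replicateCol Unit y)) i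
      rw [map_neg, hX, hvec, Matrix.neg_apply, neg_nonneg] at h1
      exact le_antisymm h1 h2
    ext i
    exact congrFun (congrFun h0 i) ()
  have hdet0 : (X y).det = 0 := Complex.ext hdet (hXherm y).det_im
  obtain ⟨v, hv, hXv⟩ := Matrix.exists_mulVec_eq_zero_iff.2 hdet0
  obtain ⟨M, hM⟩ := hpsd.exists_eq_mul_conjTranspose_of_singular hv hXv
  exact ⟨fun i => M i 0, y, hy, by rw [← hcol, ← hM, hX]⟩

/-- Two regular pairs of matrices whose summed Gram matrices agree on some families of vectors
already have a common Gram matrix of single vectors, provided both pencils have an eigenvector. -/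
theorem exists_common_gram {κ : Type*} [Fintype κ] {F G : Fin 2 → Matrix κ κ ℂ}
    (hF : ∀ v, (∀ i, F i *ᵥ v = 0) → v = 0) (hG : ∀ v, (∀ i, G i *ᵥ v = 0) → v = 0)
    {c d : Fin 2 → ℂ} (hc : c ≠ 0) (hd : d ≠ 0) {x₁ y₁ : κ → ℂ} (hx₁ : x₁ ≠ 0) (hy₁ : y₁ ≠ 0)
    (hcx : (∑ i, c i • F i) *ᵥ x₁ = 0) (hdy : (∑ i, d i • G i) *ᵥ y₁ = 0) {m₁ m₂ : ℕ}
    {L₁ : Matrix κ (Fin m₁) ℂ} {L₂ : Matrix κ (Fin m₂) ℂ}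
    (h : gram F (L₁ * L₁ᴴ) = gram G (L₂ * L₂ᴴ)) (h0 : L₁ ≠ 0 ∨ L₂ ≠ 0) :
    ∃ x y : κ → ℂ, (x ≠ 0 ∨ y ≠ 0) ∧
      gram F (Matrix.vecMulVec x (star x)) = gram G (Matrix.vecMulVec y (star y)) := by
  obtain ⟨k₁, k₂, N₁, N₂, hk, hN, hN0⟩ := exists_gram_eq_le_five F G h h0
  have hcol : ∀ M : Matrix κ (Fin 1) ℂ,
      M * Mᴴ = Matrix.vecMulVec (fun i => M i 0) (star fun i => M i 0) := by
    intro M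
    ext i j
    simp [Matrix.mul_apply, Matrix.vecMulVec_apply]
  have hne : ∀ M : Matrix κ (Fin 1) ℂ, M ≠ 0 → (fun i => M i 0) ≠ 0 := by
    intro M hM hz
    apply hM
    ext i j
    rw [Subsingleton.elim j 0]
    exact congrFun hz i
  have hzero : N₁ ≠ 0 ∧ N₂ ≠ 0 := by
    by_contra hcon
    have hzz : N₁ = 0 ∨ N₂ = 0 := by tauto
    rcases hzz with hz | hz
    · refine hN0.elim (fun h => h hz) fun h => h (eq_zero_of_gram_eq_zero hG fun i => ?_)
      simp [← hN, hz]
    · refine hN0.elim (fun h => h (eq_zero_of_gram_eq_zero hF fun i => ?_)) fun h => h hz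
      simp [hN, hz]
  have hpull : ∀ (E : Fin 2 → Matrix κ κ ℂ) (L : Matrix κ (Fin 2) ℂ) (v : Fin 2 → ℂ),
      gram (fun i => E i * L) (Matrix.vecMulVec v (star v)) =
        gram E (Matrix.vecMulVec (L *ᵥ v) (star (L *ᵥ v))) := by
    intro E L v
    rw [gram_mul, Matrix.mul_vecMulVec, Matrix.vecMulVec_mul, Matrix.star_mulVec]
  have hk1 : k₁ ≤ 2 := by nlinarith
  have hk2 : k₂ ≤ 2 := by nlinarith
  -- Beyond the cases with a zero factor, the bound 5 admits `(1, 1)`, `(1, 2)` and `(2, 1)` but not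
  -- `(2, 2)`.
  interval_cases k₁ <;> interval_cases k₂
  · exact absurd (Subsingleton.elim _ _) hzero.1
  · exact absurd (Subsingleton.elim _ _) hzero.1
  · exact absurd (Subsingleton.elim _ _) hzero.1
  · exact absurd (Subsingleton.elim _ _) hzero.2
  · exact ⟨_, fun i => N₂ i 0, Or.inl (hne N₁ hzero.1), by rw [← hcol, ← hcol N₂, hN]⟩
  · rw [hcol N₁] at hN
    obtain ⟨v, y, hy, hvy⟩ := exists_gram_vecMulVec_eq (fun i => G i * N₂) F hF (hne N₁ hzero.1)
      hx₁ (by rw [gram_mul, Matrix.mul_one, hN]) hc hcx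
    exact ⟨y, N₂ *ᵥ v, Or.inl hy, by rw [← hvy, hpull]⟩
  · exact absurd (Subsingleton.elim _ _) hzero.2
  · rw [hcol N₂] at hN
    obtain ⟨v, y, hy, hvy⟩ := exists_gram_vecMulVec_eq (fun i => F i * N₁) G hG (hne N₂ hzero.2)
      hy₁ (by rw [gram_mul, Matrix.mul_one, hN]) hd hdy
    exact ⟨N₁ *ᵥ v, y, Or.inr hy, by rw [← hvy, hpull]⟩
  · omega
end

/-! ### Compactness of convex hulls -/

theorem isCompact_convexHull_of_finiteDimensional {E : Type*} [NormedAddCommGroup E]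
    [NormedSpace ℝ E] [FiniteDimensional ℝ E] {s : Set E} (hs : IsCompact s) :
    IsCompact (convexHull ℝ s) := by
  let N := Module.finrank ℝ E + 1
  let f : (Fin N → ℝ) × (Fin N → E) → E := fun p => ∑ i, p.1 i • p.2 i
  have hf : Continuous f := by fun_prop
  have hK : IsCompact ((stdSimplex ℝ (Fin N)) ×ˢ (Set.univ.pi fun _ : Fin N => s)) :=
    (isCompact_stdSimplex ℝ (Fin N)).prod (isCompact_univ_pi fun _ => hs)
  convert hK.image hf
  ext x
  constructor
  · intro hx
    obtain ⟨x₀, hx₀⟩ := convexHull_nonempty_iff.1 ⟨x, hx⟩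
    obtain ⟨ι, _, z, w, hz, hind, hw, hw1, hwz⟩ := eq_pos_convex_span_of_mem_convexHull hx
    have hcard : Fintype.card ι ≤ Fintype.card (Fin N) := by
      rw [Fintype.card_fin]
      exact hind.card_le_finrank_succ.trans (Nat.succ_le_succ (Submodule.finrank_le _))
    obtain ⟨g⟩ := Function.Embedding.nonempty_of_card_le hcard
    have hout : ∀ j ∉ Set.range g, Function.extend g w 0 j = 0 := fun j hj =>
      Function.extend_apply' _ _ _ hj
    -- Carathéodory's combination is padded to exactly `N` points, with weight zero at the spare
    -- point `x₀`.
    refine ⟨(Function.extend g w 0, Function.extend g z fun _ => x₀), ⟨⟨fun j => ?_, ?_⟩, ?_⟩, ?_⟩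
    · by_cases hj : j ∈ Set.range g
      · obtain ⟨i, rfl⟩ := hj
        simp only [g.injective.extend_apply]
        exact (hw i).le
      · exact (hout j hj).ge
    · rw [← hw1]
      exact (Fintype.sum_of_injective g g.injective _ _ hout fun i =>
        (g.injective.extend_apply _ _ _).symm).symm
    · rintro j -
      by_cases hj : j ∈ Set.range g
      · obtain ⟨i, rfl⟩ := hj
        simp only [g.injective.extend_apply]
        exact hz ⟨i, rfl⟩
      · simp only [Function.extend_apply' _ _ _ hj]
        exact hx₀
    · rw [← hwz]
      refine (Fintype.sum_of_injective g g.injective _ _ (fun j hj => ?_) fun i => ?_).symm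
      · simp only [hout j hj, zero_smul]
      · simp only [g.injective.extend_apply]
  · rintro ⟨⟨w, z⟩, ⟨⟨hw, hw1⟩, hz⟩, rfl⟩
    exact mem_convexHull_of_exists_fintype w z hw hw1 (fun i => hz i trivial) rfl

/-! ### The Gram defect and its convex hull -/

theorem gram_vecMulVec {κ ι : Type*} [Fintype κ] [Fintype ι] (F : Fin 2 → Matrix κ ι ℂ)
    (v : ι → ℂ) (i j : Fin 2) :
    gram F (Matrix.vecMulVec v (star v)) i j = (F i *ᵥ v) ⬝ᵥ star (F j *ᵥ v) := by
  rw [gram_apply, Matrix.mul_vecMulVec, Matrix.vecMulVec_mul, ← Matrix.star_mulVec,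
    Matrix.trace_vecMulVec]

noncomputable section

/-- The difference of the Gram data of `(w, A w)` and of `(-B u, u)`. -/
def gramDefect {n : ℕ} (A B : Matrix (Fin n) (Fin n) ℂ)
    (x : EuclideanSpace ℂ (Fin n) × EuclideanSpace ℂ (Fin n)) : ℝ × ℝ × ℂ :=
  (‖x.1‖ ^ 2 - ‖Matrix.toEuclideanLin B x.2‖ ^ 2, ‖Matrix.toEuclideanLin A x.1‖ ^ 2 - ‖x.2‖ ^ 2,
    inner ℂ (Matrix.toEuclideanLin A x.1) x.1 + inner ℂ x.2 (Matrix.toEuclideanLin B x.2))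

/-- The Hermitian matrix with given diagonal and upper off-diagonal entry. -/
def hermitianOfEntries : ℝ × ℝ × ℂ →ₗ[ℝ] Matrix (Fin 2) (Fin 2) ℂ where
  toFun p := !![(p.1 : ℂ), p.2.2; conj p.2.2, (p.2.1 : ℂ)]
  map_add' p q := by ext i j; fin_cases i <;> fin_cases j <;> simp
  map_smul' c p := by ext i j; fin_cases i <;> fin_cases j <;> simp

section
variable {n : ℕ} (A B : Matrix (Fin n) (Fin n) ℂ)

theorem gram_sub_gram_eq (x : EuclideanSpace ℂ (Fin n) × EuclideanSpace ℂ (Fin n)) :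
    gram ![1, A] (Matrix.vecMulVec x.1.ofLp (star x.1.ofLp)) -
      gram ![-B, 1] (Matrix.vecMulVec x.2.ofLp (star x.2.ofLp)) =
    hermitianOfEntries (gramDefect A B x) := by
  obtain ⟨w, u⟩ := x
  have e1 : ∀ y : EuclideanSpace ℂ (Fin n), y.ofLp ⬝ᵥ star y.ofLp = ((‖y‖ ^ 2 : ℝ) : ℂ) := by
    intro y
    rw [← EuclideanSpace.inner_eq_star_dotProduct, inner_self_eq_norm_sq_to_K]
    simp
  have e2 : ∀ y z : EuclideanSpace ℂ (Fin n), y.ofLp ⬝ᵥ star z.ofLp = inner ℂ z y := fun y z => rfl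
  have e3 : ∀ (M : Matrix (Fin n) (Fin n) ℂ) (y : EuclideanSpace ℂ (Fin n)),
      M *ᵥ y.ofLp = (Matrix.toEuclideanLin M y).ofLp := fun M y => rfl
  ext i j
  rw [Matrix.sub_apply, gram_vecMulVec, gram_vecMulVec]
  fin_cases i <;> fin_cases j <;>
    simp [hermitianOfEntries, gramDefect, e3, e1, e2, -Matrix.ofLp_toLpLin]

theorem gramDefect_smul (c : ℝ) (x : EuclideanSpace ℂ (Fin n) × EuclideanSpace ℂ (Fin n)) :
    gramDefect A B ((c : ℂ) • x) = c ^ 2 • gramDefect A B x := by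
  simp only [gramDefect, Prod.smul_fst, Prod.smul_snd, map_smul, norm_smul, inner_smul_left,
    inner_smul_right, Prod.smul_mk, smul_eq_mul, Complex.norm_real, mul_pow, Complex.conj_ofReal,
    Complex.real_smul, Real.norm_eq_abs, sq_abs]
  refine Prod.ext ?_ (Prod.ext ?_ ?_)
  · simp only; ring
  · simp only; ring
  · simp only; push_cast; ring

theorem continuous_gramDefect : Continuous (gramDefect A B) := by
  have hA : Continuous (Matrix.toEuclideanLin A) := LinearMap.continuous_of_finiteDimensional _
  have hB : Continuous (Matrix.toEuclideanLin B) := LinearMap.continuous_of_finiteDimensional _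
  unfold gramDefect
  fun_prop

end

/-- A half-turn of angles suffices because `r` may have either sign. -/
theorem exists_angle (γ : ℂ) : ∃ θ ∈ Set.Ico (-(Real.pi / 2)) (Real.pi / 2), ∃ r : ℝ,
    ∀ z : ℂ, (conj γ * z).re = r * (Complex.exp (-(θ * Complex.I)) * z).re := by
  have hpi := Real.pi_pos
  suffices h : ∃ θ ∈ Set.Ico (-(Real.pi / 2)) (Real.pi / 2), ∃ r : ℝ,
      γ = r * Complex.exp (θ * Complex.I) by
    obtain ⟨θ, hθ, r, rfl⟩ := h
    refine ⟨θ, hθ, r, fun z => ?_⟩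
    rw [map_mul, ← Complex.exp_conj, map_mul, Complex.conj_I, Complex.conj_ofReal,
      Complex.conj_ofReal, mul_neg, mul_assoc, Complex.re_ofReal_mul]
  have hγ := (Complex.norm_mul_exp_arg_mul_I γ).symm
  have h1 := Complex.neg_pi_lt_arg γ
  have h2 := Complex.arg_le_pi γ
  rcases lt_or_ge γ.arg (-(Real.pi / 2)) with h | h
  · refine ⟨γ.arg + Real.pi, ⟨by linarith, by linarith⟩, -‖γ‖, ?_⟩
    rw [Complex.ofReal_add, add_mul, Complex.exp_add, Complex.exp_pi_mul_I]
    simp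
  rcases lt_or_ge γ.arg (Real.pi / 2) with h' | h'
  · exact ⟨γ.arg, ⟨h, h'⟩, ‖γ‖, hγ⟩
  · refine ⟨γ.arg - Real.pi, ⟨by linarith, by linarith⟩, -‖γ‖, ?_⟩
    rw [Complex.ofReal_sub, sub_mul, Complex.exp_sub, Complex.exp_pi_mul_I]
    simp [div_neg]

section
variable {n : ℕ} {A B : Matrix (Fin n) (Fin n) ℂ}

theorem zero_mem_convexHull_gramDefect
    (h : ∀ θ ∈ Set.Ico (-(Real.pi / 2)) (Real.pi / 2), ∃ x, x ≠ 0 ∧ (gramDefect A B x).1 = 0 ∧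
      (gramDefect A B x).2.1 = 0 ∧
      (Complex.exp (-(θ * Complex.I)) * (gramDefect A B x).2.2).re = 0) :
    0 ∈ convexHull ℝ (gramDefect A B '' Metric.sphere 0 1) := by
  by_contra h0
  have hcomp : IsCompact (convexHull ℝ (gramDefect A B '' Metric.sphere 0 1)) :=
    isCompact_convexHull_of_finiteDimensional
      ((isCompact_sphere _ _).image (continuous_gramDefect A B))
  obtain ⟨f, u, hu, hf⟩ := geometric_hahn_banach_point_closed (convex_convexHull ℝ _)
    hcomp.isClosed h0
  rw [map_zero] at hu
  -- The restriction of `f` to the complex coordinate is `z ↦ Re (conj γ * z)` for this `γ`; its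
  -- direction selects `θ`.
  obtain ⟨θ, hθ, r, hr⟩ := exists_angle ⟨f (0, 0, 1), f (0, 0, Complex.I)⟩
  obtain ⟨x, hx, h1, h2, h3⟩ := h θ hθ
  have hfx : f (gramDefect A B x) = 0 := by
    have hz : ∀ z : ℂ, f (0, 0, z) =
        r * (Complex.exp (-(θ * Complex.I)) * z).re := by
      intro z
      rw [← hr]
      have : ((0, 0, z) : ℝ × ℝ × ℂ) = z.re • (0, 0, 1) + z.im • (0, 0, Complex.I) := by
        simp
      rw [this, map_add, map_smul, map_smul]
      simp
      ring
    have : gramDefect A B x = (0, 0, (gramDefect A B x).2.2) := by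
      exact Prod.ext h1 (Prod.ext h2 rfl)
    rw [this, hz, h3, mul_zero]
  have hn : ‖x‖ ≠ 0 := norm_ne_zero_iff.2 hx
  -- By homogeneity `f` still vanishes after normalising `x`, yet it is positive on the hull.
  have hmem : gramDefect A B (((‖x‖⁻¹ : ℝ) : ℂ) • x) ∈
      convexHull ℝ (gramDefect A B '' Metric.sphere 0 1) := by
    refine subset_convexHull ℝ _ ⟨_, ?_, rfl⟩
    rw [mem_sphere_zero_iff_norm, norm_smul, Complex.norm_real, norm_inv, norm_norm,
      inv_mul_cancel₀ hn]
  have := hf _ hmem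
  rw [gramDefect_smul, map_smul, hfx, smul_zero] at this
  linarith

theorem exists_gramDefect_eq_zero_of_mem_convexHull
    (h : 0 ∈ convexHull ℝ (gramDefect A B '' Metric.sphere 0 1)) :
    ∃ x, x ≠ 0 ∧ gramDefect A B x = 0 := by
  obtain ⟨ι, _, a, z, ha, ha1, hz, hsum⟩ := mem_convexHull_iff_exists_fintype.1 h
  choose x hx hxz using hz
  let e := (Fintype.equivFin ι).symm
  let L (y : ι → EuclideanSpace ℂ (Fin n)) : Matrix (Fin n) (Fin (Fintype.card ι)) ℂ :=
    Matrix.of fun k i => (√(a (e i)) : ℂ) * y (e i) k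
  have hL : ∀ y, L y * (L y)ᴴ =
      ∑ i, a i • Matrix.vecMulVec (y i).ofLp (star (y i).ofLp) := by
    intro y
    ext k l
    rw [Matrix.mul_apply, Matrix.sum_apply, ← e.sum_comp]
    refine Finset.sum_congr rfl fun i _ => ?_
    have : ((√(a (e i)) : ℝ) : ℂ) * (√(a (e i)) : ℝ) = a (e i) := by
      rw [← Complex.ofReal_mul, Real.mul_self_sqrt (ha _)]
    simp only [L, Matrix.of_apply, Matrix.conjTranspose_apply, Matrix.smul_apply,
      Matrix.vecMulVec_apply, star_mul', Pi.star_apply, Complex.real_smul, ← this]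
    simp
    ring
  have hgram : gram ![1, A] (L (fun i => (x i).1) * (L fun i => (x i).1)ᴴ) =
      gram ![-B, 1] (L (fun i => (x i).2) * (L fun i => (x i).2)ᴴ) := by
    rw [← sub_eq_zero, hL (fun i => (x i).1), hL (fun i => (x i).2), map_sum, map_sum, ← Finset.sum_sub_distrib]
    have : ∀ i, gram ![1, A] (a i • Matrix.vecMulVec (x i).1.ofLp (star (x i).1.ofLp)) -
        gram ![-B, 1] (a i • Matrix.vecMulVec (x i).2.ofLp (star (x i).2.ofLp)) =
        hermitianOfEntries (a i • z i) := by
      intro i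
      rw [LinearMap.map_smul_of_tower, LinearMap.map_smul_of_tower, ← smul_sub, gram_sub_gram_eq,
        hxz, map_smul]
    simp only [this]
    rw [← map_sum, hsum, map_zero]
  have hne : L (fun i => (x i).1) ≠ 0 ∨ L (fun i => (x i).2) ≠ 0 := by
    by_contra! hcon
    obtain ⟨i, -, hi⟩ : ∃ i ∈ Finset.univ, a i ≠ 0 := by
      apply Finset.exists_ne_zero_of_sum_ne_zero
      rw [ha1]
      exact one_ne_zero
    have hs : (√(a i) : ℂ) ≠ 0 := by
      rw [Complex.ofReal_ne_zero]
      exact (Real.sqrt_pos.2 ((ha i).lt_of_ne' hi)).ne'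
    have hy : ∀ y : ι → EuclideanSpace ℂ (Fin n), L y = 0 → y i = 0 := by
      intro y hy
      ext k
      have := congrFun (congrFun hy k) (e.symm i)
      simpa [L, hs] using this
    have hxi := hx i
    rw [mem_sphere_zero_iff_norm] at hxi
    have : x i = 0 := Prod.ext (hy (fun i => (x i).1) hcon.1) (hy (fun i => (x i).2) hcon.2)
    simp [this] at hxi
  have hnon : Nonempty (Fin n) := by
    by_contra! hemp
    exact hne.elim (fun h => h (Subsingleton.elim _ _)) (fun h => h (Subsingleton.elim _ _))
  have heig : ∀ M : Matrix (Fin n) (Fin n) ℂ, ∃ (μ : ℂ) (v : Fin n → ℂ), v ≠ 0 ∧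
      M *ᵥ v = μ • v := by
    intro M
    obtain ⟨μ, hμ⟩ := Module.End.exists_eigenvalue (Matrix.toLin' M)
    obtain ⟨v, hv⟩ := hμ.exists_hasEigenvector
    exact ⟨μ, v, hv.2, by simpa using hv.apply_eq_smul⟩
  obtain ⟨μ, w₁, hw₁, hμ⟩ := heig A
  obtain ⟨ν, u₁, hu₁, hν⟩ := heig B
  -- The singular pencils are `A - μ` and `-B + ν`, at the eigenvectors `w₁` and `u₁`.
  obtain ⟨w, u, hwu, heq⟩ := exists_common_gram (F := ![1, A]) (G := ![-B, 1])
    (fun v hv => by simpa using hv 0) (fun v hv => by simpa using hv 1)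
    (c := ![-μ, 1]) (d := ![1, ν]) (fun h => by simpa using congrFun h 1)
    (fun h => by simpa using congrFun h 0) hw₁ hu₁
    (by simp [Matrix.add_mulVec, Matrix.neg_mulVec, Matrix.smul_mulVec, hμ])
    (by simp [Matrix.add_mulVec, Matrix.neg_mulVec, Matrix.smul_mulVec, hν]) hgram hne
  refine ⟨(WithLp.toLp 2 w, WithLp.toLp 2 u), ?_, ?_⟩
  · intro h
    rw [Prod.mk_eq_zero] at h
    simp only [WithLp.toLp_eq_zero] at h
    exact hwu.elim (fun hw => hw h.1) (fun hu => hu h.2)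
  · have h1 := gram_sub_gram_eq A B (WithLp.toLp 2 w, WithLp.toLp 2 u)
    simp only at h1
    rw [heq, sub_self] at h1
    have hij := fun i j => congrFun (congrFun h1 i) j
    refine Prod.ext ?_ (Prod.ext ?_ ?_)
    · simpa [hermitianOfEntries] using (hij 0 0).symm
    · simpa [hermitianOfEntries] using (hij 1 1).symm
    · simpa [hermitianOfEntries] using (hij 0 1).symm

end
end

/-! ### Gram data and unitary matrices -/

/-- Two pairs of vectors with the same Gram data are related by a linear isometry. -/
theorem exists_linearIsometry_of_gram_eq {E : Type*} [NormedAddCommGroup E] [InnerProductSpace ℂ E]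
    [FiniteDimensional ℂ E] {x₁ x₂ y₁ y₂ : E} (h₁ : ‖x₁‖ = ‖y₁‖) (h₂ : ‖x₂‖ = ‖y₂‖)
    (h : inner ℂ x₁ x₂ = inner ℂ y₁ y₂) : ∃ L : E →ₗᵢ[ℂ] E, L x₁ = y₁ ∧ L x₂ = y₂ := by
  let f (a b : E) : ℂ × ℂ →ₗ[ℂ] E :=
    (LinearMap.toSpanSingleton ℂ E a).coprod (LinearMap.toSpanSingleton ℂ E b)
  have hf : ∀ a b c, f a b c = c.1 • a + c.2 • b := fun a b c => rfl
  have hnorm : ∀ c, ‖f x₁ x₂ c‖ = ‖f y₁ y₂ c‖ := by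
    intro c
    rw [← sq_eq_sq₀ (norm_nonneg _) (norm_nonneg _), hf, hf, norm_add_sq (𝕜 := ℂ),
      norm_add_sq (𝕜 := ℂ)]
    simp only [norm_smul, inner_smul_left, inner_smul_right, h₁, h₂, h]
  -- Equal norms of combinations make the assignment well defined and isometric on the span; it then
  -- extends to `E`.
  have hker : LinearMap.ker (f x₁ x₂) ≤ LinearMap.ker (f y₁ y₂) := by
    intro c hc
    rw [LinearMap.mem_ker, ← norm_eq_zero] at hc ⊢
    rw [← hnorm, hc]
  let e := (f x₁ x₂).quotKerEquivRange
  let T : LinearMap.range (f x₁ x₂) →ₗ[ℂ] E :=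
    (LinearMap.ker (f x₁ x₂)).liftQ (f y₁ y₂) hker ∘ₗ e.symm.toLinearMap
  have hT : ∀ c, T ⟨f x₁ x₂ c, c, rfl⟩ = f y₁ y₂ c := by
    intro c
    have : e.symm ⟨f x₁ x₂ c, c, rfl⟩ = Submodule.Quotient.mk c := by
      rw [LinearEquiv.symm_apply_eq]
      rfl
    change (LinearMap.ker (f x₁ x₂)).liftQ (f y₁ y₂) hker (e.symm ⟨f x₁ x₂ c, c, rfl⟩) = _
    rw [this, Submodule.liftQ_apply]
  let S : LinearMap.range (f x₁ x₂) →ₗᵢ[ℂ] E := ⟨T, by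
    rintro ⟨_, c, rfl⟩
    rw [hT, ← hnorm]
    rfl⟩
  have hS : ∀ c, S.extend (f x₁ x₂ c) = f y₁ y₂ c := fun c =>
    (S.extend_apply ⟨f x₁ x₂ c, c, rfl⟩).trans (hT c)
  refine ⟨S.extend, ?_, ?_⟩
  · simpa [hf] using hS (1, 0)
  · simpa [hf] using hS (0, 1)

section
variable {n : ℕ} {A B : Matrix (Fin n) (Fin n) ℂ}

theorem toEuclideanLin_mul_apply (M N : Matrix (Fin n) (Fin n) ℂ) (x : EuclideanSpace ℂ (Fin n)) :
    Matrix.toEuclideanLin (M * N) x = Matrix.toEuclideanLin M (Matrix.toEuclideanLin N x) := by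
  ext i
  simp

theorem inner_toEuclideanLin_conjTranspose (M : Matrix (Fin n) (Fin n) ℂ)
    (x y : EuclideanSpace ℂ (Fin n)) :
    inner ℂ x (Matrix.toEuclideanLin Mᴴ y) = inner ℂ (Matrix.toEuclideanLin M x) y := by
  rw [Matrix.toEuclideanLin_conjTranspose_eq_adjoint, LinearMap.adjoint_inner_right]

theorem exists_unitary_not_isUnit_iff :
    (∃ U ∈ Matrix.unitaryGroup (Fin n) ℂ, ¬IsUnit (1 + A * Uᴴ * B * U)) ↔
      ∃ x, x ≠ 0 ∧ gramDefect A B x = 0 := by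
  constructor
  · rintro ⟨U, hU, hsing⟩
    have hUU : Uᴴ * U = 1 := Matrix.mem_unitaryGroup_iff'.1 hU
    have hUU' : U * Uᴴ = 1 := Matrix.mem_unitaryGroup_iff.1 hU
    have hin : ∀ x y, inner ℂ (Matrix.toEuclideanLin U x) (Matrix.toEuclideanLin U y) =
        (inner ℂ x y : ℂ) := by
      intro x y
      rw [← inner_toEuclideanLin_conjTranspose, ← toEuclideanLin_mul_apply, hUU]
      simp
    have hno : ∀ x, ‖Matrix.toEuclideanLin U x‖ = ‖x‖ := by
      intro x
      rw [norm_eq_sqrt_re_inner (𝕜 := ℂ), hin, ← norm_eq_sqrt_re_inner]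
    rw [Matrix.isUnit_iff_isUnit_det, isUnit_iff_ne_zero, not_not,
      ← Matrix.exists_mulVec_eq_zero_iff] at hsing
    obtain ⟨v', hv', hv0⟩ := hsing
    set v : EuclideanSpace ℂ (Fin n) := WithLp.toLp 2 v' with hv
    have hvne : v ≠ 0 := by
      rw [hv]
      simpa using hv'
    -- With `u = U v`, this choice gives `A w = v` and `U w = -B u`, so `U` carries `(A w, w)` to
    -- `(u, -B u)`.
    set w := -Matrix.toEuclideanLin (Uᴴ * B * U) v with hw
    have hAw : Matrix.toEuclideanLin A w = v := by
      have h1 : Matrix.toEuclideanLin (1 + A * Uᴴ * B * U) v = 0 :=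
        congrArg (WithLp.toLp 2) hv0
      rw [map_add, LinearMap.add_apply, mul_assoc, mul_assoc, toEuclideanLin_mul_apply] at h1
      rw [hw, map_neg, mul_assoc, neg_eq_iff_add_eq_zero, add_comm]
      simpa using h1
    have hUw : Matrix.toEuclideanLin U w =
        -Matrix.toEuclideanLin B (Matrix.toEuclideanLin U v) := by
      rw [hw, map_neg, ← toEuclideanLin_mul_apply, ← toEuclideanLin_mul_apply, ← mul_assoc,
        ← mul_assoc, hUU', one_mul]
    refine ⟨(w, Matrix.toEuclideanLin U v), ?_, ?_⟩
    · intro h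
      have h2 := (Prod.mk_eq_zero.1 h).2
      rw [← norm_eq_zero, hno, norm_eq_zero] at h2
      exact hvne h2
    · have e1 : ‖w‖ = ‖Matrix.toEuclideanLin B (Matrix.toEuclideanLin U v)‖ := by
        rw [← hno, hUw, norm_neg]
      have e2 : (inner ℂ v w : ℂ) =
          -inner ℂ (Matrix.toEuclideanLin U v)
            (Matrix.toEuclideanLin B (Matrix.toEuclideanLin U v)) := by
        rw [← hin, hUw, inner_neg_right]
      simp only [gramDefect, hAw, hno, e1, e2]
      simp
  · rintro ⟨⟨w, u⟩, hne, h0⟩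
    simp only [gramDefect, Prod.mk_eq_zero, sub_eq_zero,
      sq_eq_sq₀ (norm_nonneg _) (norm_nonneg _)] at h0
    obtain ⟨h1, h2, h3⟩ := h0
    obtain ⟨L, hL1, hL2⟩ := exists_linearIsometry_of_gram_eq
      (x₁ := Matrix.toEuclideanLin A w) (x₂ := w) (y₁ := u) (y₂ := -Matrix.toEuclideanLin B u)
      h2 (by rw [h1, norm_neg]) (by rw [inner_neg_right]; exact eq_neg_of_add_eq_zero_left h3)
    set U : Matrix (Fin n) (Fin n) ℂ := Matrix.toEuclideanLin.symm L.toLinearMap with hU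
    have hUL : ∀ x, Matrix.toEuclideanLin U x = L x := by
      intro x
      rw [hU, LinearEquiv.apply_symm_apply]
      rfl
    have hUU : Uᴴ * U = 1 := by
      apply Matrix.toEuclideanLin.injective
      ext1 x
      rw [toEuclideanLin_mul_apply]
      refine ext_inner_left ℂ fun y => ?_
      rw [inner_toEuclideanLin_conjTranspose, hUL, hUL, L.inner_map_map]
      simp
    refine ⟨U, Matrix.mem_unitaryGroup_iff'.2 hUU, fun hunit => ?_⟩
    rw [Matrix.isUnit_iff_isUnit_det, isUnit_iff_ne_zero] at hunit
    refine hunit (Matrix.exists_mulVec_eq_zero_iff.1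
      ⟨(Matrix.toEuclideanLin A w).ofLp, ?_, ?_⟩)
    · intro hz
      have hz' : Matrix.toEuclideanLin A w = 0 := by
        ext i
        exact congrFun hz i
      rw [hz', norm_zero, eq_comm, norm_eq_zero] at h2
      rw [h2, map_zero, norm_zero, norm_eq_zero] at h1
      exact hne (by rw [h1, h2]; rfl)
    · have hBU : Matrix.toEuclideanLin (A * Uᴴ * B * U) (Matrix.toEuclideanLin A w) =
          -Matrix.toEuclideanLin A w := by
        have e1 : Matrix.toEuclideanLin B u = -Matrix.toEuclideanLin U w := by
          rw [hUL, hL2, neg_neg]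
        rw [toEuclideanLin_mul_apply, hUL, hL1, toEuclideanLin_mul_apply, e1, map_neg,
          ← toEuclideanLin_mul_apply, mul_assoc, hUU, mul_one]
      have h4 : Matrix.toEuclideanLin (1 + A * Uᴴ * B * U) (Matrix.toEuclideanLin A w) = 0 := by
        rw [map_add, LinearMap.add_apply, hBU]
        simp
      exact congrArg WithLp.ofLp h4

/-! ### Shells in terms of Gram data -/

theorem mem_dwShell_iff {M : Matrix (Fin n) (Fin n) ℂ} {p : ℂ × ℝ} :
    p ∈ dwShell M ↔ ∃ x : EuclideanSpace ℂ (Fin n), x ≠ 0 ∧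
      p.1 * (‖x‖ ^ 2 : ℝ) = inner ℂ x (Matrix.toEuclideanLin M x) ∧
      p.2 * ‖x‖ ^ 2 = ‖Matrix.toEuclideanLin M x‖ ^ 2 := by
  constructor
  · rintro ⟨x, y, rfl, hx, rfl⟩
    have h1 : ‖x‖ ^ 2 ≠ 0 := pow_ne_zero 2 (norm_ne_zero_iff.2 hx)
    exact ⟨x, hx, div_mul_cancel₀ _ (Complex.ofReal_ne_zero.2 h1), div_mul_cancel₀ _ h1⟩
  · rintro ⟨x, hx, e1, e2⟩
    have h1 : ‖x‖ ^ 2 ≠ 0 := pow_ne_zero 2 (norm_ne_zero_iff.2 hx)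
    exact ⟨x, _, rfl, hx, Prod.ext (eq_div_of_mul_eq (Complex.ofReal_ne_zero.2 h1) e1)
      (eq_div_of_mul_eq h1 e2)⟩

theorem mem_invDwShell_iff {p : ℂ × ℝ} :
    p ∈ invDwShell A ↔ ∃ w : EuclideanSpace ℂ (Fin n), Matrix.toEuclideanLin A w ≠ 0 ∧
      p.1 * (‖Matrix.toEuclideanLin A w‖ ^ 2 : ℝ) = inner ℂ (Matrix.toEuclideanLin A w) w ∧
      p.2 * ‖Matrix.toEuclideanLin A w‖ ^ 2 = ‖w‖ ^ 2 := by
  constructor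
  · rintro ⟨q, ⟨⟨x, y, rfl, hx, rfl⟩, hq⟩, rfl⟩
    have hy : Matrix.toEuclideanLin A x ≠ 0 := by
      intro hy
      apply hq
      simp [hy]
    have h1 : (‖x‖ : ℂ) ≠ 0 := Complex.ofReal_ne_zero.2 (norm_ne_zero_iff.2 hx)
    have h2 : (‖Matrix.toEuclideanLin A x‖ : ℂ) ≠ 0 :=
      Complex.ofReal_ne_zero.2 (norm_ne_zero_iff.2 hy)
    have h1' := norm_ne_zero_iff.2 hx
    have h2' := norm_ne_zero_iff.2 hy
    refine ⟨x, hy, ?_, ?_⟩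
    · simp only [shellInv, map_div₀, inner_conj_symm, Complex.conj_ofReal]
      push_cast
      field_simp
    · simp only [shellInv]
      field_simp
  · rintro ⟨x, hy, e1, e2⟩
    have hx : x ≠ 0 := by
      rintro rfl
      simp at hy
    have h1 : (‖x‖ : ℂ) ≠ 0 := Complex.ofReal_ne_zero.2 (norm_ne_zero_iff.2 hx)
    have h2 : (‖Matrix.toEuclideanLin A x‖ : ℂ) ≠ 0 :=
      Complex.ofReal_ne_zero.2 (norm_ne_zero_iff.2 hy)
    have h1' := norm_ne_zero_iff.2 hx
    have h2' := norm_ne_zero_iff.2 hy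
    refine ⟨_, ⟨⟨x, _, rfl, hx, rfl⟩, ?_⟩, ?_⟩
    · intro h
      have := congrArg Prod.snd h
      simp only [div_eq_zero_iff] at this
      simp [h1', h2', -Matrix.ofLp_toLpLin] at this
    · refine Prod.ext ?_ ?_
      · simp only [shellInv, map_div₀, inner_conj_symm, Complex.conj_ofReal]
        rw [← e1]
        push_cast
        field_simp
      · simp only [shellInv]
        field_simp
        linarith

/-- Coincidences between the inverse shell of `A` and the shell of `-B`, up to a real-linear map of
the first coordinate, correspond to zeros of the Gram defect. -/
theorem exists_mem_shells_iff {V : Type*} [AddCommGroup V] [Module ℝ V] (ℓ : ℂ →ₗ[ℝ] V) :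
    (∃ p ∈ invDwShell A, ∃ q ∈ dwShell (-B), ℓ p.1 = ℓ q.1 ∧ p.2 = q.2) ↔
      ∃ x, x ≠ 0 ∧ (gramDefect A B x).1 = 0 ∧ (gramDefect A B x).2.1 = 0 ∧
        ℓ (gramDefect A B x).2.2 = 0 := by
  have hsmul : ∀ (r : ℝ) (z : ℂ), z * (r : ℂ) = r • z := fun r z => by
    rw [Complex.real_smul, mul_comm]
  constructor
  · rintro ⟨p, hp, q, hq, h1, h2⟩
    obtain ⟨w, hw, e1, e2⟩ := mem_invDwShell_iff.1 hp
    obtain ⟨u, hu, e3, e4⟩ := mem_dwShell_iff.1 hq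
    have hn1 := norm_ne_zero_iff.2 hw
    have hn2 := norm_ne_zero_iff.2 hu
    rw [map_neg, LinearMap.neg_apply, inner_neg_right] at e3
    rw [map_neg, LinearMap.neg_apply, norm_neg] at e4
    -- Shell points ignore scaling, so `w` may be rescaled to make `‖A w‖ = ‖u‖`.
    set c : ℝ := ‖u‖ / ‖Matrix.toEuclideanLin A w‖ with hc
    have hc2 : c ^ 2 * ‖Matrix.toEuclideanLin A w‖ ^ 2 = ‖u‖ ^ 2 := by
      rw [hc]
      field_simp
    refine ⟨((c : ℂ) • w, u), fun h => hu (Prod.mk_eq_zero.1 h).2, ?_, ?_, ?_⟩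
    · simp only [gramDefect, norm_smul, Complex.norm_real, mul_pow, Real.norm_eq_abs, sq_abs]
      rw [← e2, ← e4, ← hc2, h2]
      ring
    · simp only [gramDefect, map_smul, norm_smul, Complex.norm_real, mul_pow, Real.norm_eq_abs,
        sq_abs]
      rw [hc2, sub_self]
    · have e5 : inner ℂ (Matrix.toEuclideanLin A ((c : ℂ) • w)) ((c : ℂ) • w) =
          p.1 * ((‖u‖ ^ 2 : ℝ) : ℂ) := by
        rw [map_smul, inner_smul_left, inner_smul_right, ← e1, ← hc2, Complex.conj_ofReal]
        push_cast
        ring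
      simp only [gramDefect]
      rw [e5, neg_eq_iff_eq_neg.1 e3.symm, map_add, map_neg, hsmul, hsmul, map_smul, map_smul,
        h1, add_neg_cancel]
  · rintro ⟨⟨w, u⟩, hne, h1, h2, h3⟩
    simp only [gramDefect, sub_eq_zero, sq_eq_sq₀ (norm_nonneg _) (norm_nonneg _)] at h1 h2 h3
    have hu : u ≠ 0 := by
      rintro rfl
      rw [map_zero, norm_zero, norm_eq_zero] at h1
      exact hne (by rw [h1]; rfl)
    have hn := norm_ne_zero_iff.2 hu
    have hn' : ((‖u‖ ^ 2 : ℝ) : ℂ) ≠ 0 := Complex.ofReal_ne_zero.2 (pow_ne_zero 2 hn)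
    refine ⟨(inner ℂ (Matrix.toEuclideanLin A w) w / (‖u‖ ^ 2 : ℝ), ‖w‖ ^ 2 / ‖u‖ ^ 2),
      mem_invDwShell_iff.2 ⟨w, ?_, ?_, ?_⟩,
      (-inner ℂ u (Matrix.toEuclideanLin B u) / (‖u‖ ^ 2 : ℝ), ‖w‖ ^ 2 / ‖u‖ ^ 2),
      mem_dwShell_iff.2 ⟨u, hu, ?_, ?_⟩, ?_, rfl⟩
    · rw [← norm_ne_zero_iff, h2]
      exact hn
    · rw [h2]
      exact div_mul_cancel₀ _ hn'
    · rw [h2]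
      exact div_mul_cancel₀ _ (pow_ne_zero 2 hn)
    · rw [map_neg, LinearMap.neg_apply, inner_neg_right]
      exact div_mul_cancel₀ _ hn'
    · rw [map_neg, LinearMap.neg_apply, norm_neg, ← h1]
      exact div_mul_cancel₀ _ (pow_ne_zero 2 hn)
    · simp only [div_eq_mul_inv, ← Complex.ofReal_inv, hsmul, map_smul]
      rw [map_add] at h3
      rw [map_neg, eq_neg_of_add_eq_zero_left h3]

end

/-! ### The θ-SRGs as intersections of lines and circles -/

theorem norm_exp_neg_mul_I (θ : ℝ) : ‖Complex.exp (-(θ * Complex.I))‖ = 1 := by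
  rw [← neg_mul, ← Complex.ofReal_neg, Complex.norm_exp_ofReal_mul_I]

theorem exp_mul_eq_iff (θ : ℝ) (z ω : ℂ) :
    Complex.exp (θ * Complex.I) * z = ω ↔ Complex.exp (-(θ * Complex.I)) * ω = z := by
  rw [Complex.exp_neg, inv_mul_eq_iff_eq_mul₀ (Complex.exp_ne_zero _), eq_comm]

theorem eq_mk_sqrt_or_iff {a : ℂ} {t r : ℝ} (h : t ^ 2 ≤ r) :
    (a = ⟨t, √(r - t ^ 2)⟩ ∨ a = ⟨t, -√(r - t ^ 2)⟩) ↔ a.re = t ∧ ‖a‖ ^ 2 = r := by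
  rw [Complex.sq_norm, Complex.normSq_apply]
  have hs := Real.sq_sqrt (sub_nonneg.2 h)
  constructor
  · rintro (rfl | rfl)
    · exact ⟨rfl, by simp only; linarith⟩
    · exact ⟨rfl, by simp only; linarith⟩
  · rintro ⟨h1, h2⟩
    have : a.im ^ 2 = √(r - t ^ 2) ^ 2 := by
      rw [hs, ← h1, ← h2]
      ring
    exact (sq_eq_sq_iff_eq_or_eq_neg.1 this).imp (fun h => Complex.ext h1 h)
      (fun h => Complex.ext h1 h)

theorem sq_re_le_sq_norm (a : ℂ) : a.re ^ 2 ≤ ‖a‖ ^ 2 :=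
  sq_le_sq.2 (by rw [abs_norm]; exact Complex.abs_re_le_norm a)

section
variable {n : ℕ} {A : Matrix (Fin n) (Fin n) ℂ}

theorem sq_norm_le_of_mem_invDwShell {p : ℂ × ℝ} (hp : p ∈ invDwShell A) : ‖p.1‖ ^ 2 ≤ p.2 := by
  obtain ⟨x, hx, e1, e2⟩ := mem_invDwShell_iff.1 hp
  have hn := norm_pos_iff.2 hx
  have h1 := norm_inner_le_norm (𝕜 := ℂ) (Matrix.toEuclideanLin A x) x
  rw [← e1, norm_mul, Complex.norm_real, norm_pow, norm_norm] at h1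
  have h2 : ‖p.1‖ * ‖Matrix.toEuclideanLin A x‖ ≤ ‖x‖ := by
    nlinarith
  have h3 : (‖p.1‖ * ‖Matrix.toEuclideanLin A x‖) ^ 2 ≤ ‖x‖ ^ 2 := by gcongr
  rw [← e2, mul_pow] at h3
  exact le_of_mul_le_mul_right h3 (by positivity)

theorem pos_of_mem_invDwShell {p : ℂ × ℝ} (hp : p ∈ invDwShell A) : 0 < p.2 := by
  obtain ⟨x, hx, e1, e2⟩ := mem_invDwShell_iff.1 hp
  have hx0 : x ≠ 0 := by
    rintro rfl
    simp at hx
  have h1 := norm_pos_iff.2 hx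
  have h2 := norm_pos_iff.2 hx0
  have h3 : 0 < p.2 * ‖Matrix.toEuclideanLin A x‖ ^ 2 := by
    rw [e2]
    positivity
  exact pos_of_mul_pos_left h3 (by positivity)

theorem mem_invThetaSrg_iff {θ : ℝ} {ω : ℂ} :
    ω ∈ invThetaSrg θ A ↔ ∃ p ∈ invDwShell A,
      (Complex.exp (-(θ * Complex.I)) * ω).re = (Complex.exp (-(θ * Complex.I)) * p.1).re ∧
        ‖ω‖ ^ 2 = p.2 := by
  have key : ∀ p ∈ invDwShell A, ((thetaProj θ p).1 = ω ∨ (thetaProj (θ + Real.pi) p).1 = ω) ↔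
      (Complex.exp (-(θ * Complex.I)) * ω).re = (Complex.exp (-(θ * Complex.I)) * p.1).re ∧
        ‖ω‖ ^ 2 = p.2 := by
    intro p hp
    set a := Complex.exp (-(θ * Complex.I)) * ω with ha
    set b := Complex.exp (-(θ * Complex.I)) * p.1 with hb
    have hna : ‖ω‖ = ‖a‖ := by rw [ha, norm_mul, norm_exp_neg_mul_I, one_mul]
    have hnb : ‖p.1‖ = ‖b‖ := by rw [hb, norm_mul, norm_exp_neg_mul_I, one_mul]
    have hle : b.re ^ 2 ≤ p.2 :=
      (sq_re_le_sq_norm b).trans (by rw [← hnb]; exact sq_norm_le_of_mem_invDwShell hp)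
    rw [hna, ← eq_mk_sqrt_or_iff hle]
    have h1 : (thetaProj θ p).1 = ω ↔ a = ⟨b.re, √(p.2 - b.re ^ 2)⟩ := exp_mul_eq_iff _ _ _
    -- Adding `π` negates both exponentials, which keeps the real part and selects the lower root.
    have h2 : (thetaProj (θ + Real.pi) p).1 = ω ↔ a = ⟨b.re, -√(p.2 - b.re ^ 2)⟩ := by
      have e1 : Complex.exp (((θ + Real.pi : ℝ) : ℂ) * Complex.I) =
          -Complex.exp (θ * Complex.I) := by
        rw [Complex.ofReal_add, add_mul, Complex.exp_add, Complex.exp_pi_mul_I, mul_neg_one]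
      have e2 : Complex.exp (-(((θ + Real.pi : ℝ) : ℂ) * Complex.I)) =
          -Complex.exp (-(θ * Complex.I)) := by
        rw [Complex.exp_neg, e1, Complex.exp_neg, inv_neg]
      simp only [thetaProj, parabProj]
      rw [e1, e2, neg_mul, neg_mul, ← hb, ← mul_neg, exp_mul_eq_iff, ← ha]
      have : -(⟨(-b).re, √(p.2 - (-b).re ^ 2)⟩ : ℂ) = ⟨b.re, -√(p.2 - b.re ^ 2)⟩ := by
        apply Complex.ext <;> simp
      rw [this]
    rw [h1, h2]
  constructor
  · rintro (⟨p, hp, h⟩ | ⟨p, hp, h⟩)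
    · exact ⟨p, hp, (key p hp).1 (Or.inl h)⟩
    · exact ⟨p, hp, (key p hp).1 (Or.inr h)⟩
  · rintro ⟨p, hp, h⟩
    exact ((key p hp).2 h).imp (fun h => ⟨p, hp, h⟩) (fun h => ⟨p, hp, h⟩)

/-- By Cauchy–Schwarz the argument `k` of `arccos` lies in `[-1, 1]`; its cosine `k` and sine `√(1 -
k²)` then give the same line and circle as the projection of the shell. -/
theorem mem_thetaSrg_iff {θ : ℝ} {ω : ℂ} :
    ω ∈ thetaSrg θ A ↔ ∃ p ∈ dwShell A, p.2 ≠ 0 ∧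
      (Complex.exp (-(θ * Complex.I)) * ω).re = (Complex.exp (-(θ * Complex.I)) * p.1).re ∧
        ‖ω‖ ^ 2 = p.2 := by
  set c := Complex.exp (-(θ * Complex.I)) with hc
  set a := c * ω with ha
  have hnc : ‖c‖ = 1 := norm_exp_neg_mul_I θ
  have hna : ‖ω‖ = ‖a‖ := by rw [ha, norm_mul, hnc, one_mul]
  have h0 : ω ∈ thetaSrg θ A ↔ a ∈ srg (c • A) := by
    constructor
    · rintro ⟨s, hs, h⟩
      rwa [ha, hc, (exp_mul_eq_iff θ s ω).1 h]
    · intro h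
      exact ⟨a, h, (exp_mul_eq_iff θ a ω).2 rfl⟩
  have hy : ∀ x, Matrix.toEuclideanLin (c • A) x = c • Matrix.toEuclideanLin A x := by
    intro x
    rw [map_smul, LinearMap.smul_apply]
  have hny : ∀ x, ‖Matrix.toEuclideanLin (c • A) x‖ = ‖Matrix.toEuclideanLin A x‖ := by
    intro x
    rw [hy, norm_smul, hnc, one_mul]
  have key : ∀ x : EuclideanSpace ℂ (Fin n), x ≠ 0 → Matrix.toEuclideanLin A x ≠ 0 →
      ((∃ s : ℝ, (s = 1 ∨ s = -1) ∧
        a = ((‖Matrix.toEuclideanLin (c • A) x‖ / ‖x‖ : ℝ) : ℂ) *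
          Complex.exp (((s * Real.arccos ((inner ℂ x (Matrix.toEuclideanLin (c • A) x)).re /
            (‖x‖ * ‖Matrix.toEuclideanLin (c • A) x‖)) : ℝ) : ℂ) * Complex.I)) ↔
      a.re = (c * (inner ℂ x (Matrix.toEuclideanLin A x) / ((‖x‖ ^ 2 : ℝ) : ℂ))).re ∧
        ‖a‖ ^ 2 = ‖Matrix.toEuclideanLin A x‖ ^ 2 / ‖x‖ ^ 2) := by
    intro x hx hAx
    have hx' := norm_pos_iff.2 hx
    have hAx' := norm_pos_iff.2 hAx
    rw [hny, hy, inner_smul_right]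
    set z := c * inner ℂ x (Matrix.toEuclideanLin A x) with hz
    set ρ := ‖Matrix.toEuclideanLin A x‖ / ‖x‖ with hρ
    set k := z.re / (‖x‖ * ‖Matrix.toEuclideanLin A x‖) with hk
    have hρ0 : 0 < ρ := by positivity
    have hk1 : |k| ≤ 1 := by
      rw [hk, abs_div, abs_of_pos (mul_pos hx' hAx'), div_le_one (mul_pos hx' hAx')]
      refine (Complex.abs_re_le_norm z).trans ?_
      rw [hz, norm_mul, hnc, one_mul]
      exact norm_inner_le_norm _ _
    have hk2 := abs_le.1 hk1
    have hsq : k ^ 2 ≤ 1 := (sq_le_one_iff_abs_le_one k).2 hk1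
    have hle : (ρ * k) ^ 2 ≤ ρ ^ 2 := by
      rw [mul_pow]
      exact mul_le_of_le_one_right (sq_nonneg _) hsq
    have e1 : (c * (inner ℂ x (Matrix.toEuclideanLin A x) / ((‖x‖ ^ 2 : ℝ) : ℂ))).re = ρ * k := by
      rw [← mul_div_assoc, ← hz, Complex.div_ofReal_re, hρ, hk]
      field_simp
    have e2 : ‖Matrix.toEuclideanLin A x‖ ^ 2 / ‖x‖ ^ 2 = ρ ^ 2 := by rw [hρ, div_pow]
    have e3 : √(ρ ^ 2 - (ρ * k) ^ 2) = ρ * √(1 - k ^ 2) := by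
      rw [show ρ ^ 2 - (ρ * k) ^ 2 = ρ ^ 2 * (1 - k ^ 2) by ring, Real.sqrt_mul (sq_nonneg _),
        Real.sqrt_sq hρ0.le]
    have e4 : ∀ s : ℝ, (ρ : ℂ) * Complex.exp (((s * Real.arccos k : ℝ) : ℂ) * Complex.I) =
        ⟨ρ * Real.cos (s * Real.arccos k), ρ * Real.sin (s * Real.arccos k)⟩ := by
      intro s
      apply Complex.ext
      · rw [Complex.re_ofReal_mul, Complex.exp_ofReal_mul_I_re]
      · rw [Complex.im_ofReal_mul, Complex.exp_ofReal_mul_I_im]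
    rw [e1, e2, ← eq_mk_sqrt_or_iff hle, e3]
    simp only [e4, or_and_right, exists_or, exists_eq_left, one_mul, neg_one_mul, Real.cos_neg,
      Real.sin_neg, Real.cos_arccos hk2.1 hk2.2, Real.sin_arccos, mul_neg]
  rw [h0, hna]
  constructor
  · rintro ⟨x, y, rfl, hy0, h⟩
    have hx : x ≠ 0 := by
      rintro rfl
      exact hy0 (map_zero _)
    have hAx : Matrix.toEuclideanLin A x ≠ 0 := by
      rwa [← norm_ne_zero_iff, ← hny, norm_ne_zero_iff]
    refine ⟨_, ⟨x, _, rfl, hx, rfl⟩, ?_, (key x hx hAx).1 h⟩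
    have h1 := norm_pos_iff.2 hx
    have h2 := norm_pos_iff.2 hAx
    simp only
    positivity
  · rintro ⟨p, ⟨x, y, rfl, hx, rfl⟩, hp, h⟩
    have hAx : Matrix.toEuclideanLin A x ≠ 0 := by
      intro h
      apply hp
      simp [h]
    refine ⟨x, _, rfl, ?_, (key x hx hAx).2 h⟩
    rwa [← norm_ne_zero_iff, hny, norm_ne_zero_iff]

end

/-! ### The equivalences -/

section
variable {n : ℕ} {A B : Matrix (Fin n) (Fin n) ℂ}

theorem invThetaSrg_inter_thetaSrg_nonempty_iff {θ : ℝ} :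
    (invThetaSrg θ A ∩ thetaSrg θ (-B)).Nonempty ↔
      ∃ x, x ≠ 0 ∧ (gramDefect A B x).1 = 0 ∧ (gramDefect A B x).2.1 = 0 ∧
        (Complex.exp (-(θ * Complex.I)) * (gramDefect A B x).2.2).re = 0 := by
  refine Iff.trans ?_ (exists_mem_shells_iff
    (Complex.reLm ∘ₗ LinearMap.mulLeft ℝ (Complex.exp (-(θ * Complex.I)))))
  constructor
  · rintro ⟨ω, h1, h2⟩
    obtain ⟨p, hp, e1, e2⟩ := mem_invThetaSrg_iff.1 h1
    obtain ⟨q, hq, -, e3, e4⟩ := mem_thetaSrg_iff.1 h2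
    exact ⟨p, hp, q, hq, e1.symm.trans e3, e2.symm.trans e4⟩
  · rintro ⟨p, hp, q, hq, e1, e2⟩
    set b := Complex.exp (-(θ * Complex.I)) * p.1 with hb
    have hnb : ‖p.1‖ = ‖b‖ := by rw [hb, norm_mul, norm_exp_neg_mul_I, one_mul]
    have hle : b.re ^ 2 ≤ p.2 :=
      (sq_re_le_sq_norm b).trans (by rw [← hnb]; exact sq_norm_le_of_mem_invDwShell hp)
    obtain ⟨h1, h2⟩ := (eq_mk_sqrt_or_iff hle).1 (Or.inl rfl)
    -- A point where the common line meets the common circle, which exists since `b.re ^ 2 ≤ p.2`.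
    set a : ℂ := ⟨b.re, √(p.2 - b.re ^ 2)⟩ with ha
    have h3 : Complex.exp (-(θ * Complex.I)) * (Complex.exp (θ * Complex.I) * a) = a :=
      (exp_mul_eq_iff θ a _).1 rfl
    have h4 : ‖Complex.exp (θ * Complex.I) * a‖ = ‖a‖ := by
      rw [norm_mul, Complex.norm_exp_ofReal_mul_I, one_mul]
    refine ⟨Complex.exp (θ * Complex.I) * a, mem_invThetaSrg_iff.2 ⟨p, hp, ?_, ?_⟩,
      mem_thetaSrg_iff.2 ⟨q, hq, ?_, ?_, ?_⟩⟩
    · rw [h3, h1]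
    · rw [h4, h2]
    · rw [← e2]
      exact (pos_of_mem_invDwShell hp).ne'
    · rw [h3, h1]
      exact e1
    · rw [h4, h2, e2]

theorem invDwShell_inter_dwShell_nonempty_iff :
    (invDwShell A ∩ dwShell (-B)).Nonempty ↔ ∃ x, x ≠ 0 ∧ gramDefect A B x = 0 := by
  have h := exists_mem_shells_iff (A := A) (B := B) (LinearMap.id : ℂ →ₗ[ℝ] ℂ)
  refine Iff.trans ⟨?_, ?_⟩ (h.trans ⟨?_, ?_⟩)
  · rintro ⟨p, hp, hq⟩
    exact ⟨p, hp, p, hq, rfl, rfl⟩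
  · rintro ⟨p, hp, q, hq, h1, h2⟩
    have hpq : p = q := Prod.ext h1 h2
    exact ⟨p, hp, hpq ▸ hq⟩
  · rintro ⟨x, hx, h1, h2, h3⟩
    exact ⟨x, hx, Prod.ext h1 (Prod.ext h2 h3)⟩
  · rintro ⟨x, hx, h0⟩
    exact ⟨x, hx, by simp [h0]⟩

theorem exists_theta_iff :
    (∃ θ ∈ Set.Ico (-(Real.pi / 2)) (Real.pi / 2), invThetaSrg θ A ∩ thetaSrg θ (-B) = ∅) ↔
      ¬∃ x, x ≠ 0 ∧ gramDefect A B x = 0 := by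
  constructor
  · rintro ⟨θ, -, hθ⟩ ⟨x, hx, h0⟩
    exact (invThetaSrg_inter_thetaSrg_nonempty_iff.2 ⟨x, hx, by simp [h0]⟩).ne_empty hθ
  · intro h
    by_contra! hcon
    exact h (exists_gramDefect_eq_zero_of_mem_convexHull (zero_mem_convexHull_gramDefect
      fun θ hθ => invThetaSrg_inter_thetaSrg_nonempty_iff.1 (hcon θ hθ)))

end

theorem mainTheorem1 (n : ℕ) (A B : Matrix (Fin n) (Fin n) ℂ) :
    ((∀ U ∈ Matrix.unitaryGroup (Fin n) ℂ, IsUnit (1 + A * Uᴴ * B * U)) ↔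
      ∃ θ ∈ Set.Ico (-(Real.pi / 2)) (Real.pi / 2),
        invThetaSrg θ A ∩ thetaSrg θ (-B) = ∅) ∧
    ((∃ θ ∈ Set.Ico (-(Real.pi / 2)) (Real.pi / 2),
        invThetaSrg θ A ∩ thetaSrg θ (-B) = ∅) ↔
      invDwShell A ∩ dwShell (-B) = ∅) := by
  rw [exists_theta_iff, ← exists_unitary_not_isUnit_iff]
  refine ⟨by push Not; rfl, ?_⟩
  rw [exists_unitary_not_isUnit_iff, ← invDwShell_inter_dwShell_nonempty_iff,
    Set.not_nonempty_iff_eq_empty]
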